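/- **Setting.** Let $n\ge 1$ be an integer. Fix a non-decreasing $\mathcal C^2$ function $\varphi_{\mathbb R}:[0,\infty)\to[0,\infty)$ with $\chi_{[4,\infty)}\le\varphi_{\mathbb R}\le\chi_{[1/4,\infty)}$ and $|\varphi_{\mathbb R}'|$ bounded below away from zero on $[1/3,3]$. For $z\in\mathbb R^d$ and $\epsilon>0$ put $\varphi_\epsilon(z)=\varphi_{\mathbb R}(|z|^2/\epsilon^2)$ and $K(z)=z/|z|^{n+1}$ for $z\ne0$ (and $K(0)=0$). For a Borel measure $\mu$ on $\mathbb R^d$ and $m\in\mathbb Z$ put $$S_m\mu(x)=\int\big(\varphi_{2^{-m-1}}(x-y)-\varphi_{2^{-m}}(x-y)\big)K(x-y)\,d\mu(y).$$ The measure $\mu$ is called $n$-dimensional AD regular with constant $C_\mu>0$ if $C_\mu^{-1}r^n\le\mu(B(x,r))\le C_\mu r^n$ for all $x\in\operatorname{supp}\mu$ and $0<r\le\operatorname{diam}(\operatorname{supp}\mu)$; here only measures with $\operatorname{diam}(\operatorname{supp}\mu)=\infty$ are considered. A dyadic lattice of $\mu$-cubes is a sequence $(\mathcal D_j)_{j\in\mathbb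 Z}$ of families of Borel subsets of $\operatorname{supp}\mu$ for which there is a constant $C>0$ such that: (a) each $\mathcal D_j$ is a partition of $\operatorname{supp}\mu$; (b) if $Q\in\mathcal D_j$, $Q'\in\mathcal D_k$ and $k\le j$, then $Q\subset Q'$ or $Q\cap Q'=\emptyset$; (c) $C^{-1}2^{-j}\le\operatorname{diam}(Q)\le2^{-j}$ and $C^{-1}2^{-jn}\le\mu(Q)\le C2^{-jn}$ for all $Q\in\mathcal D_j$; (d) for all $Q\in\mathcal D_j$ and $0<\tau<1$, $$\mu(\{x\in Q:\operatorname{dist}(x,\operatorname{supp}\mu\setminus Q)\le\tau2^{-j}\})+\mu(\{x\in\operatorname{supp}\mu\setminus Q:\operatorname{dist}(x,Q)\le\tau2^{-j}\})\le C\tau^{1/C}2^{-jn}.$$ For $Q\in\mathcal D_j$ put $\ell(Q)=2^{-j}$ (a $\mu$-cube carries its generation $j$), $aQ=\{x\in\operatorname{supp}\mu:\operatorname{dist}(x,Q)\le(a-1)\ell(Q)\}$ for $a>1$, and $$\beta_{1,\mu}(Q)=\inf_L\frac1{\ell(Q)^n}\int_{2Q}\frac{\operatorname{dist}(y,L)}{\ell(Q)}\,d\mu(y),$$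 the infimum being over all affine $n$-planes $L\subset\mathbb R^d$. **Proposition.** Given $\epsilon_0>0$ and $C_\mu$, there exist $\delta_0>0$ and $m_0,k_0\in\mathbb N$, depending only on $\epsilon_0$, $n$, $C_\mu$ (and the fixed function $\varphi_{\mathbb R}$), such that the following holds for every $d>n$, every $n$-dimensional AD regular Borel measure $\mu$ on $\mathbb R^d$ with constant $C_\mu$ and $\operatorname{diam}(\operatorname{supp}\mu)=\infty$, and every dyadic lattice $(\mathcal D_j)_{j\in\mathbb Z}$ of $\mu$-cubes. For all $i\in\mathbb Z$ and all $Q\in\mathcal D_i$ with $\beta_{1,\mu}(Q)>\epsilon_0$ there exist $k\in\mathbb Z$ with $|k|\le k_0$ and $P\in\mathcal D_{i+k+m_0}$ such that $P\subset4Q$ and $|S_{i+k}\mu(x)|\ge\delta_0$ for all $x\in P$. -/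

import Mathlib

open MeasureTheory Set

noncomputable section

/-- The cut-off profiles `φ` on `[0, ∞)` (only the values of `φ` on `[0, ∞)` are ever used):
non-negative, non-decreasing, of class `C²`, with `χ_{[4,∞)} ≤ φ ≤ χ_{[1/4,∞)}` and with
`|φ'|` bounded away from zero on `[1/3, 3]`. -/
structure IsTruncationProfile (φ : ℝ → ℝ) : Prop where
  nonneg : ∀ t, 0 ≤ t → 0 ≤ φ t
  monotoneOn : MonotoneOn φ (Ici 0)
  contDiffOn : ContDiffOn ℝ 2 φ (Ici 0)
  lower : ∀ t, 0 ≤ t → (Ici (4 : ℝ)).indicator (fun _ => (1 : ℝ)) t ≤ φ t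
  upper : ∀ t, 0 ≤ t → φ t ≤ (Ici (1 / 4 : ℝ)).indicator (fun _ => (1 : ℝ)) t
  deriv_lower : ∃ C : ℝ, 0 < C ∧ ∀ t ∈ Icc (1 / 3 : ℝ) 3, 1 ≤ C * |deriv φ t|

/-- The smooth truncation `φ_ε(z) = φ(|z|² / ε²)`. -/
def truncation {d : ℕ} (φ : ℝ → ℝ) (ε : ℝ) (z : EuclideanSpace ℝ (Fin d)) : ℝ :=
  φ (‖z‖ ^ 2 / ε ^ 2)

/-- The `n`-dimensional Riesz kernel `K(z) = z / |z|^{n+1}` in `ℝ^d`. -/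
def rieszKernel (n : ℕ) {d : ℕ} (z : EuclideanSpace ℝ (Fin d)) : EuclideanSpace ℝ (Fin d) :=
  (‖z‖ ^ (n + 1))⁻¹ • z

/-- The dyadic piece of the Riesz transform,
`S_m μ(x) = ∫ (φ_{2^{-m-1}}(x - y) - φ_{2^{-m}}(x - y)) K(x - y) dμ(y)`. -/
def rieszPiece (n : ℕ) {d : ℕ} (φ : ℝ → ℝ) (μ : Measure (EuclideanSpace ℝ (Fin d))) (m : ℤ)
    (x : EuclideanSpace ℝ (Fin d)) : EuclideanSpace ℝ (Fin d) :=
  ∫ y, (truncation φ ((2 : ℝ) ^ (-m - 1)) (x - y) - truncation φ ((2 : ℝ) ^ (-m)) (x - y)) •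
    rieszKernel n (x - y) ∂μ

/-- `μ` is `n`-dimensional Ahlfors-David regular with constant `C`:
`C⁻¹ rⁿ ≤ μ(B(x,r)) ≤ C rⁿ` for all `x ∈ supp μ` and `0 < r ≤ diam(supp μ)`. -/
structure IsADRegular (n : ℕ) {d : ℕ} (C : ℝ) (μ : Measure (EuclideanSpace ℝ (Fin d))) :
    Prop where
  const_pos : 0 < C
  lower : ∀ x ∈ μ.support, ∀ r : ℝ, 0 < r → ENNReal.ofReal r ≤ Metric.ediam μ.support →
    ENNReal.ofReal (C⁻¹ * r ^ n) ≤ μ (Metric.closedBall x r)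
  upper : ∀ x ∈ μ.support, ∀ r : ℝ, 0 < r → ENNReal.ofReal r ≤ Metric.ediam μ.support →
    μ (Metric.closedBall x r) ≤ ENNReal.ofReal (C * r ^ n)

/-- `D` is a lattice of dyadic `μ`-cubes in the sense of David for a measure `μ` with unbounded
support: `D j` is the family of the cubes of generation `j`, whose side length is `2^{-j}`. -/
structure IsDyadicLattice (n : ℕ) {d : ℕ} (μ : Measure (EuclideanSpace ℝ (Fin d)))
    (D : ℤ → Set (Set (EuclideanSpace ℝ (Fin d)))) : Prop where
  measurableSet : ∀ j, ∀ Q ∈ D j, MeasurableSet Q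
  sUnion_eq : ∀ j, ⋃₀ D j = μ.support
  disjoint : ∀ j, ∀ Q ∈ D j, ∀ Q' ∈ D j, Q ≠ Q' → Disjoint Q Q'
  nested : ∀ j k, k ≤ j → ∀ Q ∈ D j, ∀ Q' ∈ D k, Q ⊆ Q' ∨ Disjoint Q Q'
  diam_le : ∀ j, ∀ Q ∈ D j, Metric.ediam Q ≤ ENNReal.ofReal ((2 : ℝ) ^ (-j))
  size : ∃ C : ℝ, 0 < C ∧ ∀ j, ∀ Q ∈ D j,
    ENNReal.ofReal (C⁻¹ * (2 : ℝ) ^ (-j)) ≤ Metric.ediam Q ∧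
    ENNReal.ofReal (C⁻¹ * ((2 : ℝ) ^ (-j)) ^ n) ≤ μ Q ∧
    μ Q ≤ ENNReal.ofReal (C * ((2 : ℝ) ^ (-j)) ^ n)
  small_boundary : ∃ C : ℝ, 0 < C ∧ ∀ j, ∀ Q ∈ D j, ∀ τ : ℝ, 0 < τ → τ < 1 →
    μ {x | x ∈ Q ∧ Metric.infDist x (μ.support \ Q) ≤ τ * (2 : ℝ) ^ (-j)} +
      μ {x | x ∈ μ.support \ Q ∧ Metric.infDist x Q ≤ τ * (2 : ℝ) ^ (-j)} ≤
    ENNReal.ofReal (C * τ ^ (1 / C) * ((2 : ℝ) ^ (-j)) ^ n)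

/-- The dilation `aQ = {x ∈ supp μ : dist(x, Q) ≤ (a - 1) ℓ}` of a `μ`-cube `Q` of side
length `ℓ`. -/
def cubeDilate {d : ℕ} (μ : Measure (EuclideanSpace ℝ (Fin d))) (a ℓ : ℝ)
    (Q : Set (EuclideanSpace ℝ (Fin d))) : Set (EuclideanSpace ℝ (Fin d)) :=
  {x | x ∈ μ.support ∧ Metric.infDist x Q ≤ (a - 1) * ℓ}

/-- The coefficient `β_{1,μ}(Q) = inf_L ℓ^{-n} ∫_{2Q} dist(y, L) / ℓ dμ(y)` of a `μ`-cube `Q` of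
side length `ℓ`, the infimum being over all affine `n`-planes `L`. -/
def betaOne (n : ℕ) {d : ℕ} (μ : Measure (EuclideanSpace ℝ (Fin d))) (ℓ : ℝ)
    (Q : Set (EuclideanSpace ℝ (Fin d))) : ℝ :=
  ⨅ L : {L : AffineSubspace ℝ (EuclideanSpace ℝ (Fin d)) //
      (L : Set (EuclideanSpace ℝ (Fin d))).Nonempty ∧ Module.finrank ℝ L.direction = n},
    (ℓ ^ n)⁻¹ * ∫ y in cubeDilate μ 2 ℓ Q,
      Metric.infDist y (L.1 : Set (EuclideanSpace ℝ (Fin d))) / ℓ ∂μ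

end

/-!
The argument is by contradiction. Let `ℓ = 2⁻ⁱ` and suppose that `S_m μ` is small somewhere on every
admissible cube `P`. As `S_m μ` has Lipschitz constant `O(2ᵐ)` on the support
(`IsADRegular.norm_rieszPiece_sub_le`), it is then small at every point of `2Q`, for all scales
`2⁻ᵐ` between `ℓ` and `2ᴺ ℓ`. Adding the pieces (`IsADRegular.sum_rieszPiece`), the difference
`R_ε μ - R_{ε'} μ` of two smooth truncations, with `ℓ ≪ ε ≪ ε' = 2ᴺ ℓ`, is small on `2Q`.

Fix `x₀ ∈ Q`. By Taylor expansion of the kernel (`IsRadialProfile.norm_radialField_sub_sub_le`),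
`R_ε μ(x) - R_ε μ(x₀) = T((x - x₀) / ε) + O(ℓ² / ε²)` for a linear map `T`, the
`linearizedTransform`, while the increments of `R_{ε'} μ` are `O(ℓ / ε')`. Hence `T` is small on
the increments `x - x₀`, `x ∈ 2Q`.

If `β_{1,μ}(Q) > ε₀`, then no `n`-plane through `x₀` is close to all of `2Q`
(`IsADRegular.betaOne_le`), and a quantitative Gram–Schmidt process applied to such increments
yields `n + 1` orthonormal vectors on which `T` is small (`exists_orthonormal_norm_map_le`). So
the trace of `T` over some `(n+1)`-dimensional subspace is small. But with `Π` the projection onto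
that subspace, the trace of the differential of `φ(|z|²) z / |z|^{n+1}` is
`((n + 1) φ(|z|²) (1 - |Πz|² / |z|²) + 2 φ'(|z|²) |Πz|²) / |z|^{n+1}`, which is non-negative, and
bounded below for `3/4 ≤ |z| ≤ 3/2` (`IsCutoff.trace_nonneg`, `IsCutoff.trace_lower`). Choosing
`ε` such that the corresponding annulus around `x₀` carries mass `≳ εⁿ`
(`IsADRegular.exists_annulus`) makes the trace of `T` bounded below
(`IsADRegular.le_sum_inner_linearizedTransform`), a contradiction. All estimates depend on `n`,
`φ`, the regularity constant and `ε₀` only, and not on the ambient dimension or the lattice.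
-/

/-! ### The cut-off profile -/

/-- A globally defined cut-off profile with its first two derivatives `φ₁`, `φ₂`: it vanishes on
`(-∞, 1/4)`, takes values in `[0, 1]`, is non-decreasing, has scale-invariant derivative bounds
with constant `B`, and both `φ` and `φ₁` are at least `c` on `[9/16, 9/4]`. -/
structure IsCutoff (φ φ₁ φ₂ : ℝ → ℝ) (B c : ℝ) : Prop where
  hasDerivAt : ∀ t, HasDerivAt φ (φ₁ t) t
  hasDerivAt' : ∀ t, HasDerivAt φ₁ (φ₂ t) t
  eq_zero : ∀ t, t < 1 / 4 → φ t = 0 ∧ φ₁ t = 0 ∧ φ₂ t = 0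
  eq_one : ∀ t, 4 < t → φ t = 1
  nonneg : ∀ t, 0 ≤ φ t
  le_one : ∀ t, φ t ≤ 1
  deriv_nonneg : ∀ t, 0 ≤ φ₁ t
  deriv_le : ∀ t, 0 < t → t * φ₁ t ≤ B
  deriv2_le : ∀ t, 0 < t → t ^ 2 * |φ₂ t| ≤ B
  c_pos : 0 < c
  lower : ∀ t ∈ Icc (9 / 16 : ℝ) (9 / 4), c ≤ φ t ∧ c ≤ φ₁ t

/-- A truncation profile agrees on `[0, ∞)` with a cut-off defined on all of `ℝ`, namely its
extension by zero. -/
theorem IsTruncationProfile.exists_isCutoff {φ : ℝ → ℝ} (hφ : IsTruncationProfile φ) :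
    ∃ (ψ ψ₁ ψ₂ : ℝ → ℝ) (B c : ℝ), IsCutoff ψ ψ₁ ψ₂ B c ∧ ∀ t, 0 ≤ t → ψ t = φ t := by
  set ψ : ℝ → ℝ := fun t => if t < 1 / 4 then 0 else φ t with hψ
  have hzero : ∀ t, t < 1 / 4 → ψ t = 0 := fun t ht => by simp only [hψ]; rw [if_pos ht]
  have heq : ∀ t, 0 ≤ t → ψ t = φ t := by
    intro t ht
    by_cases h : t < 1 / 4
    · have h1 := hφ.upper t ht
      rw [indicator_of_notMem (by simpa using h)] at h1
      rw [hzero t h]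
      exact le_antisymm (hφ.nonneg t ht) h1
    · simp only [hψ]; rw [if_neg h]
  have hone : ∀ t, 4 ≤ t → ψ t = 1 := by
    intro t ht
    have ht0 : (0 : ℝ) ≤ t := by linarith
    rw [heq t ht0]
    have h1 := hφ.upper t ht0
    have h2 := hφ.lower t ht0
    rw [indicator_of_mem (by simp only [mem_Ici]; linarith)] at h1
    rw [indicator_of_mem (by simpa using ht)] at h2
    exact le_antisymm h1 h2
  have hnn : ∀ t, 0 ≤ ψ t := by
    intro t
    by_cases h : t < 1 / 4
    · rw [hzero t h]
    · rw [heq t (by linarith)]; exact hφ.nonneg t (by linarith)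
  have hmono : Monotone ψ := by
    intro s t hst
    by_cases h : s < 1 / 4
    · rw [hzero s h]; exact hnn t
    · rw [heq s (by linarith), heq t (by linarith)]
      exact hφ.monotoneOn (by simp only [mem_Ici]; linarith) (by simp only [mem_Ici]; linarith) hst
  have hle : ∀ t, ψ t ≤ 1 := fun t =>
    (hmono (le_max_left t 4)).trans (hone _ (le_max_right t 4)).le
  have hnear : ∀ t, 0 < t → ψ =ᶠ[nhds t] φ := fun t ht => by
    filter_upwards [Ioi_mem_nhds ht] with s hs using heq s (le_of_lt hs)
  have hC2 : ContDiff ℝ 2 ψ := by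
    rw [contDiff_iff_contDiffAt]
    intro t
    by_cases h : t < 1 / 4
    · have : ψ =ᶠ[nhds t] fun _ => 0 := by
        filter_upwards [Iio_mem_nhds h] with s hs using hzero s hs
      exact contDiffAt_const.congr_of_eventuallyEq this
    · have ht : 0 < t := by linarith
      exact (hφ.contDiffOn.contDiffAt (Ici_mem_nhds ht)).congr_of_eventuallyEq (hnear t ht)
  have hC1 : ContDiff ℝ 1 (deriv ψ) :=
    ContDiff.deriv' (n := 1) (by simpa [one_add_one_eq_two] using hC2)
  have hC0 : Continuous (deriv (deriv ψ)) := hC1.continuous_deriv le_rfl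
  have hd0 : ∀ t, HasDerivAt ψ (deriv ψ t) t := fun t =>
    (hC2.differentiable (by norm_num) t).hasDerivAt
  have hd1 : ∀ t, HasDerivAt (deriv ψ) (deriv (deriv ψ) t) t := fun t =>
    (hC1.differentiable (by norm_num) t).hasDerivAt
  have hz1 : ∀ t, t < 1 / 4 → deriv ψ t = 0 := fun t ht => by
    have : ψ =ᶠ[nhds t] fun _ => 0 := by
      filter_upwards [Iio_mem_nhds ht] with s hs using hzero s hs
    rw [this.deriv_eq]; simp
  have hz2 : ∀ t, t < 1 / 4 → deriv (deriv ψ) t = 0 := fun t ht => by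
    have : deriv ψ =ᶠ[nhds t] fun _ => 0 := by
      filter_upwards [Iio_mem_nhds ht] with s hs using hz1 s hs
    rw [this.deriv_eq]; simp
  have ho1 : ∀ t, 4 < t → deriv ψ t = 0 := fun t ht => by
    have : ψ =ᶠ[nhds t] fun _ => 1 := by
      filter_upwards [Ioi_mem_nhds ht] with s hs using hone s (le_of_lt hs)
    rw [this.deriv_eq]; simp
  have ho2 : ∀ t, 4 < t → deriv (deriv ψ) t = 0 := fun t ht => by
    have : deriv ψ =ᶠ[nhds t] fun _ => 0 := by
      filter_upwards [Ioi_mem_nhds ht] with s hs using ho1 s hs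
    rw [this.deriv_eq]; simp
  obtain ⟨B₁, hB₁⟩ := (isCompact_Icc (a := (0 : ℝ)) (b := 4)).exists_bound_of_continuousOn
    hC1.continuous.continuousOn
  obtain ⟨B₂, hB₂⟩ := (isCompact_Icc (a := (0 : ℝ)) (b := 4)).exists_bound_of_continuousOn
    hC0.continuousOn
  have hB₁0 : 0 ≤ B₁ := (norm_nonneg _).trans (hB₁ 0 (by simp))
  have hB₂0 : 0 ≤ B₂ := (norm_nonneg _).trans (hB₂ 0 (by simp))
  obtain ⟨C, hC, hlow⟩ := hφ.deriv_lower
  have hdnn : ∀ t, 0 ≤ deriv ψ t := fun t => hmono.deriv_nonneg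
  have hlow' : ∀ t ∈ Icc (1 / 3 : ℝ) 3, C⁻¹ ≤ deriv ψ t := by
    intro t ht
    have h1 := hlow t ht
    rw [← (hnear t (by linarith [ht.1])).deriv_eq, abs_of_nonneg (hdnn t)] at h1
    rwa [inv_le_iff_one_le_mul₀' hC]
  -- The mean value inequality on `[1/3, 9/16]` turns the bound for `φ'` into one for `φ`.
  have hval : C⁻¹ * (11 / 48) ≤ ψ (9 / 16) := by
    have h1 : C⁻¹ * ((9 / 16 : ℝ) - 1 / 3) ≤ ψ (9 / 16) - ψ (1 / 3) :=
      (convex_Icc (1 / 3 : ℝ) (9 / 16)).mul_sub_le_image_sub_of_le_deriv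
        hC2.continuous.continuousOn (fun x _ => (hd0 x).differentiableAt.differentiableWithinAt)
        (fun x hx => hlow' x (by
          rw [interior_Icc] at hx
          exact ⟨hx.1.le, by linarith [hx.2]⟩))
        _ (by constructor <;> norm_num) _ (by constructor <;> norm_num) (by norm_num)
    have h2 := hnn (1 / 3)
    norm_num at h1 h2 ⊢
    linarith
  have hCinv : 0 < C⁻¹ := inv_pos.2 hC
  refine ⟨ψ, deriv ψ, deriv (deriv ψ), 4 * B₁ + 16 * B₂, C⁻¹ * (11 / 48), ?_, heq⟩
  refine ⟨hd0, hd1, fun t ht => ⟨hzero t ht, hz1 t ht, hz2 t ht⟩, fun t ht => hone t ht.le, hnn,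
    hle, hdnn, ?_, ?_, by positivity, ?_⟩
  · intro t ht
    by_cases h : t ≤ 4
    · have h1 := (le_abs_self _).trans (hB₁ t ⟨ht.le, h⟩)
      nlinarith [hdnn t, mul_le_mul h h1 (hdnn t) (by norm_num)]
    · rw [ho1 t (by linarith)]; simp only [mul_zero]; positivity
  · intro t ht
    by_cases h : t ≤ 4
    · have h1 := hB₂ t ⟨ht.le, h⟩
      rw [Real.norm_eq_abs] at h1
      have h2 : t ^ 2 ≤ 16 := by nlinarith
      nlinarith [mul_le_mul h2 h1 (abs_nonneg _) (by norm_num)]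
    · rw [ho2 t (by linarith)]; simp only [abs_zero, mul_zero]; positivity
  · intro t ht
    refine ⟨hval.trans (hmono ht.1), ?_⟩
    refine le_trans ?_ (hlow' t ⟨by linarith [ht.1], by linarith [ht.2]⟩)
    linarith

/-! ### Radial vector fields and the truncated Riesz kernel -/

section RadialField

variable {E : Type*} [NormedAddCommGroup E] [InnerProductSpace ℝ E]

/-- The radial vector field `w ↦ g(|w|²) w`. -/
def radialField (g : ℝ → ℝ) (w : E) : E := g (‖w‖ ^ 2) • w

/-- The differential `v ↦ g(|w|²) v + 2 g'(|w|²) ⟪w, v⟫ w` of `radialField g` at `w`, where `g₁`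
stands for `g'`. -/
noncomputable def radialFieldDeriv (g g₁ : ℝ → ℝ) (w : E) : E →L[ℝ] E :=
  g (‖w‖ ^ 2) • ContinuousLinearMap.id ℝ E +
    (2 * g₁ (‖w‖ ^ 2)) • (innerSL ℝ w).smulRight w

theorem radialFieldDeriv_apply (g g₁ : ℝ → ℝ) (w v : E) :
    radialFieldDeriv g g₁ w v =
      g (‖w‖ ^ 2) • v + (2 * g₁ (‖w‖ ^ 2)) • (inner ℝ w v • w) := by
  simp [radialFieldDeriv]

/-- `g`, `g₁ = g'` and `g₂ = g''` decay so fast that `w ↦ g(|w|²) w` behaves like a kernel of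
homogeneity `-n` which is smooth at the origin. -/
structure IsRadialProfile (n : ℕ) (A : ℝ) (g g₁ g₂ : ℝ → ℝ) : Prop where
  hasDerivAt : ∀ t, HasDerivAt g (g₁ t) t
  hasDerivAt' : ∀ t, HasDerivAt g₁ (g₂ t) t
  pos : 0 < A
  le : ∀ r, 0 ≤ r → |g (r ^ 2)| ≤ A / (1 + r) ^ (n + 1)
  deriv_le : ∀ r, 0 ≤ r → |g₁ (r ^ 2)| ≤ A / (1 + r) ^ (n + 3)
  deriv2_le : ∀ r, 0 ≤ r → |g₂ (r ^ 2)| ≤ A / (1 + r) ^ (n + 5)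

theorem abs_mul_pow_le_div {A a r : ℝ} (hA : 0 ≤ A) (hr : 0 ≤ r) {p q m : ℕ}
    (h : |a| ≤ A / (1 + r) ^ p) (hp : p = q + m) : |a| * r ^ m ≤ A / (1 + r) ^ q := by
  have h1 : r ^ m ≤ (1 + r) ^ m := pow_le_pow_left₀ hr (by linarith) m
  calc |a| * r ^ m ≤ A / (1 + r) ^ p * (1 + r) ^ m :=
        mul_le_mul h h1 (by positivity) (by positivity)
    _ = A / (1 + r) ^ q := by
        rw [hp, pow_add]; field_simp

namespace IsRadialProfile

variable {n : ℕ} {A : ℝ} {g g₁ g₂ : ℝ → ℝ}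

theorem continuous (h : IsRadialProfile n A g g₁ g₂) : Continuous g :=
  continuous_iff_continuousAt.2 fun t => (h.hasDerivAt t).continuousAt

theorem continuous' (h : IsRadialProfile n A g g₁ g₂) : Continuous g₁ :=
  continuous_iff_continuousAt.2 fun t => (h.hasDerivAt' t).continuousAt

theorem continuous_radialField (h : IsRadialProfile n A g g₁ g₂) :
    Continuous (radialField g : E → E) := by
  have := h.continuous
  unfold radialField
  fun_prop

theorem continuous_radialFieldDeriv [FiniteDimensional ℝ E] (h : IsRadialProfile n A g g₁ g₂) :
    Continuous (radialFieldDeriv g g₁ : E → E →L[ℝ] E) := by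
  have := h.continuous
  have := h.continuous'
  rw [continuous_clm_apply]
  intro v
  simp only [radialFieldDeriv_apply]
  fun_prop

theorem norm_radialField_le (h : IsRadialProfile n A g g₁ g₂) (w : E) : ‖radialField g w‖ ≤ A := by
  have h1 := abs_mul_pow_le_div h.pos.le (norm_nonneg w) (h.le _ (norm_nonneg w))
    (q := n) (m := 1) rfl
  rw [radialField, norm_smul, Real.norm_eq_abs]
  rw [pow_one] at h1
  refine h1.trans (div_le_self h.pos.le ?_)
  exact one_le_pow₀ (by linarith [norm_nonneg w])

theorem hasFDerivAt_radialField (h : IsRadialProfile n A g g₁ g₂) (w : E) :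
    HasFDerivAt (radialField g) (radialFieldDeriv g g₁ w) w := by
  have h1 : HasFDerivAt (fun w : E => ‖w‖ ^ 2) (2 • (innerSL ℝ w)) w :=
    (hasStrictFDerivAt_norm_sq w).hasFDerivAt
  have h2 := (h.hasDerivAt (‖w‖ ^ 2)).comp_hasFDerivAt w h1
  have h3 := h2.smul (hasFDerivAt_id w)
  refine h3.congr_fderiv ?_
  ext v
  simp only [radialFieldDeriv, add_apply, smul_apply,
    ContinuousLinearMap.smulRight_apply, ContinuousLinearMap.id_apply, Function.comp, smul_smul,
    id, smul_eq_mul, nsmul_eq_mul]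
  congr 2
  push_cast
  ring

theorem norm_radialFieldDeriv_le (h : IsRadialProfile n A g g₁ g₂) (w : E) :
    ‖radialFieldDeriv g g₁ w‖ ≤ 3 * A / (1 + ‖w‖) ^ (n + 1) := by
  have hA := h.pos
  refine ContinuousLinearMap.opNorm_le_bound _ (by positivity) fun v => ?_
  rw [radialFieldDeriv_apply]
  have h0 := h.le _ (norm_nonneg w)
  have h1 := abs_mul_pow_le_div h.pos.le (norm_nonneg w) (h.deriv_le _ (norm_nonneg w))
    (q := n + 1) (m := 2) rfl
  calc _ ≤ ‖g (‖w‖ ^ 2) • v‖ + ‖(2 * g₁ (‖w‖ ^ 2)) • (inner ℝ w v • w)‖ := norm_add_le _ _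
    _ ≤ |g (‖w‖ ^ 2)| * ‖v‖ + 2 * |g₁ (‖w‖ ^ 2)| * (‖w‖ * ‖v‖ * ‖w‖) := by
        simp only [norm_smul, norm_mul, Real.norm_eq_abs, abs_two]
        gcongr
        exact abs_real_inner_le_norm w v
    _ = (|g (‖w‖ ^ 2)| + 2 * (|g₁ (‖w‖ ^ 2)| * ‖w‖ ^ 2)) * ‖v‖ := by ring
    _ ≤ (A / (1 + ‖w‖) ^ (n + 1) + 2 * (A / (1 + ‖w‖) ^ (n + 1))) * ‖v‖ := by gcongr
    _ = _ := by ring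

theorem div_one_add_norm_pow_le {F : Type*} [NormedAddCommGroup F] {z w : F} {a : ℝ} (ha : 0 ≤ a) (m : ℕ)
    (hw : w ∈ Metric.closedBall z (1 / 2)) :
    a / (1 + ‖w‖) ^ m ≤ 2 ^ m * a / (1 + ‖z‖) ^ m := by
  have h1 : ‖z‖ ≤ ‖w‖ + 1 / 2 := by
    rw [mem_closedBall_iff_norm'] at hw
    linarith [norm_le_norm_add_norm_sub w z, norm_sub_rev w z]
  have h2 : (1 + ‖z‖) ^ m ≤ 2 ^ m * (1 + ‖w‖) ^ m := by
    rw [← mul_pow]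
    exact pow_le_pow_left₀ (by positivity) (by linarith [norm_nonneg w]) m
  rw [div_le_div_iff₀ (by positivity) (by positivity)]
  calc a * (1 + ‖z‖) ^ m ≤ a * (2 ^ m * (1 + ‖w‖) ^ m) := by gcongr
    _ = _ := by ring

/-- First-order estimate for the kernel, with decay of order `n + 1`. -/
theorem norm_radialField_sub_le (h : IsRadialProfile n A g g₁ g₂) (z v : E) (hv : ‖v‖ ≤ 1 / 2) :
    ‖radialField g (z + v) - radialField g z‖ ≤
      2 ^ (n + 1) * (3 * A) / (1 + ‖z‖) ^ (n + 1) * ‖v‖ := by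
  have hA := h.pos
  have := (convex_closedBall z (1 / 2)).norm_image_sub_le_of_norm_hasFDerivWithin_le
    (fun w _ => (h.hasFDerivAt_radialField w).hasFDerivWithinAt)
    (fun w hw => (h.norm_radialFieldDeriv_le w).trans
      (div_one_add_norm_pow_le (by positivity) (n + 1) hw))
    (Metric.mem_closedBall_self (by norm_num))
    (show z + v ∈ Metric.closedBall z (1 / 2) by simpa using hv)
  simpa using this

theorem norm_radialFieldDeriv_sub_apply_le (h : IsRadialProfile n A g g₁ g₂) (z w x : E)
    (hw : ‖w - z‖ ≤ 1 / 2) :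
    ‖radialFieldDeriv g g₁ w x - radialFieldDeriv g g₁ z x‖ ≤
      2 ^ (n + 2) * (10 * A) / (1 + ‖z‖) ^ (n + 2) * ‖w - z‖ * ‖x‖ := by
  have hA := h.pos
  set v := w - z with hv
  let γ : ℝ → E := fun s => z + s • v
  have hγ : ∀ s, HasDerivAt γ v s := fun s => by
    simpa [γ, add_comm] using ((hasDerivAt_id s).smul_const v).const_add z
  have hu : ∀ s, HasDerivAt (fun s => ‖γ s‖ ^ 2) (2 * inner ℝ (γ s) v) s := fun s =>
    (hγ s).norm_sq
  have hin : ∀ s, HasDerivAt (fun s => inner ℝ (γ s) x) (inner ℝ v x) s := fun s => by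
    simpa using (hγ s).inner ℝ (hasDerivAt_const s x)
  have hD : ∀ s, HasDerivAt (fun s => radialFieldDeriv g g₁ (γ s) x)
      ((g₁ (‖γ s‖ ^ 2) * (2 * inner ℝ (γ s) v)) • x +
        ((2 * g₁ (‖γ s‖ ^ 2)) • (inner ℝ (γ s) x • v + inner ℝ v x • γ s) +
          (2 * (g₂ (‖γ s‖ ^ 2) * (2 * inner ℝ (γ s) v))) • (inner ℝ (γ s) x • γ s))) s := by
    intro s
    simp only [radialFieldDeriv_apply]
    have a1 := ((h.hasDerivAt (‖γ s‖ ^ 2)).comp s (hu s)).smul_const x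
    have a2 := ((h.hasDerivAt' (‖γ s‖ ^ 2)).comp s (hu s)).const_mul 2
    exact a1.add (a2.smul ((hin s).smul (hγ s)))
  have key := norm_image_sub_le_of_norm_deriv_le_segment_01'
    (f := fun s => radialFieldDeriv g g₁ (γ s) x)
    (C := 2 ^ (n + 2) * (10 * A) / (1 + ‖z‖) ^ (n + 2) * ‖v‖ * ‖x‖)
    (fun s _ => (hD s).hasDerivWithinAt) ?_
  · have e1 : γ 1 = w := by simp [γ, hv]
    have e0 : γ 0 = z := by simp [γ]
    simpa only [e1, e0] using key
  intro s hs
  set p := γ s with hp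
  have hpz : p ∈ Metric.closedBall z (1 / 2) := by
    simp only [hp, γ, mem_closedBall_iff_norm, add_sub_cancel_left, norm_smul, Real.norm_eq_abs,
      abs_of_nonneg hs.1]
    nlinarith [norm_nonneg v, hs.2]
  have h1 := abs_mul_pow_le_div h.pos.le (norm_nonneg p) (h.deriv_le _ (norm_nonneg p))
    (q := n + 2) (m := 1) rfl
  have h2 := abs_mul_pow_le_div h.pos.le (norm_nonneg p) (h.deriv2_le _ (norm_nonneg p))
    (q := n + 2) (m := 3) rfl
  have hiv := abs_real_inner_le_norm p v
  have hix := abs_real_inner_le_norm p x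
  have hvx := abs_real_inner_le_norm v x
  calc _ ≤ |g₁ (‖p‖ ^ 2)| * (2 * (‖p‖ * ‖v‖)) * ‖x‖ +
        (2 * |g₁ (‖p‖ ^ 2)| * (‖p‖ * ‖x‖ * ‖v‖ + ‖v‖ * ‖x‖ * ‖p‖) +
          2 * (|g₂ (‖p‖ ^ 2)| * (2 * (‖p‖ * ‖v‖))) * (‖p‖ * ‖x‖ * ‖p‖)) := by
        refine (norm_add_le _ _).trans (add_le_add ?_ ((norm_add_le _ _).trans
          (add_le_add ?_ ?_)))
        · simp only [norm_smul, norm_mul, Real.norm_eq_abs, abs_two]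
          gcongr
        · rw [norm_smul, norm_mul, Real.norm_eq_abs, Real.norm_eq_abs, abs_two]
          gcongr
          refine (norm_add_le _ _).trans ?_
          simp only [norm_smul, Real.norm_eq_abs]
          gcongr
        · simp only [norm_smul, norm_mul, Real.norm_eq_abs, abs_two]
          gcongr
    _ = (6 * (|g₁ (‖p‖ ^ 2)| * ‖p‖ ^ 1) + 4 * (|g₂ (‖p‖ ^ 2)| * ‖p‖ ^ 3)) * ‖v‖ * ‖x‖ := by ring
    _ ≤ (6 * (A / (1 + ‖p‖) ^ (n + 2)) + 4 * (A / (1 + ‖p‖) ^ (n + 2))) * ‖v‖ * ‖x‖ := by gcongr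
    _ = 10 * A / (1 + ‖p‖) ^ (n + 2) * ‖v‖ * ‖x‖ := by ring
    _ ≤ _ := by
        gcongr ?_ * _ * _
        exact div_one_add_norm_pow_le (by positivity) (n + 2) hpz

/-- Second-order Taylor estimate for the kernel, with decay of order `n + 2`. -/
theorem norm_radialField_sub_sub_le (h : IsRadialProfile n A g g₁ g₂) (z v : E)
    (hv : ‖v‖ ≤ 1 / 2) :
    ‖radialField g (z + v) - radialField g z - radialFieldDeriv g g₁ z v‖ ≤
      2 ^ (n + 2) * (10 * A) / (1 + ‖z‖) ^ (n + 2) * ‖v‖ ^ 2 := by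
  have hA := h.pos
  have := (convex_closedBall z ‖v‖).norm_image_sub_le_of_norm_hasFDerivWithin_le'
    (φ := radialFieldDeriv g g₁ z)
    (C := 2 ^ (n + 2) * (10 * A) / (1 + ‖z‖) ^ (n + 2) * ‖v‖)
    (fun w _ => (h.hasFDerivAt_radialField w).hasFDerivWithinAt)
    (fun w hw => by
      rw [mem_closedBall_iff_norm] at hw
      refine ContinuousLinearMap.opNorm_le_bound _ (by positivity) fun x => ?_
      rw [sub_apply]
      refine (h.norm_radialFieldDeriv_sub_apply_le z w x (hw.trans hv)).trans ?_
      gcongr)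
    (Metric.mem_closedBall_self (norm_nonneg v))
    (show z + v ∈ Metric.closedBall z ‖v‖ by simp)
  rw [add_sub_cancel_left] at this
  exact this.trans_eq (by ring)

end IsRadialProfile

theorem sum_inner_radialFieldDeriv {ι : Type*} [Fintype ι] (g g₁ : ℝ → ℝ) (w : E) {e : ι → E}
    (he : Orthonormal ℝ e) :
    ∑ i, inner ℝ (e i) (radialFieldDeriv g g₁ w (e i)) =
      Fintype.card ι * g (‖w‖ ^ 2) + 2 * g₁ (‖w‖ ^ 2) * ∑ i, inner ℝ (e i) w ^ 2 := by
  have : ∀ i, inner ℝ (e i) (radialFieldDeriv g g₁ w (e i)) =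
      g (‖w‖ ^ 2) + 2 * g₁ (‖w‖ ^ 2) * inner ℝ (e i) w ^ 2 := by
    intro i
    rw [radialFieldDeriv_apply, inner_add_right, inner_smul_right, inner_smul_right,
      inner_smul_right, real_inner_self_eq_norm_sq, he.1 i, real_inner_comm]
    ring
  simp only [this, Finset.sum_add_distrib, Finset.sum_const, ← Finset.mul_sum, nsmul_eq_mul,
    Finset.card_univ]

end RadialField

/-! ### The profile of the Riesz kernel -/

section RieszProfile

variable {φ φ₁ φ₂ : ℝ → ℝ} {B c : ℝ}

theorem sq_rpow_neg_half (n : ℕ) {r : ℝ} (hr : 0 < r) :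
    (r ^ 2) ^ (-((n : ℝ) + 1) / 2) = (r ^ (n + 1))⁻¹ := by
  rw [← Real.rpow_natCast r 2, ← Real.rpow_mul hr.le, ← Real.rpow_natCast r (n + 1),
    ← Real.rpow_neg hr.le]
  congr 1
  push_cast
  ring

theorem inv_pow_le_of_half_le {r : ℝ} (hr : 1 / 2 ≤ r) (m : ℕ) :
    (r ^ m)⁻¹ ≤ 3 ^ m / (1 + r) ^ m := by
  rw [inv_eq_one_div, div_le_div_iff₀ (by positivity) (by positivity), one_mul, ← mul_pow]
  exact pow_le_pow_left₀ (by positivity) (by linarith) m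

/-- The profile `t ↦ φ(t) t^{-(n+1)/2}`, for which `radialField` is the truncated Riesz kernel. -/
noncomputable def rieszProfile (n : ℕ) (φ : ℝ → ℝ) (t : ℝ) : ℝ := φ t * t ^ (-((n : ℝ) + 1) / 2)

/-- The derivative of `rieszProfile n φ` when `φ₁` is the derivative of `φ`. -/
noncomputable def rieszProfileDeriv (n : ℕ) (φ φ₁ : ℝ → ℝ) (t : ℝ) : ℝ :=
  φ₁ t * t ^ (-((n : ℝ) + 1) / 2) +
    φ t * ((-((n : ℝ) + 1) / 2) * t ^ (-((n : ℝ) + 1) / 2 - 1))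

theorem sq_rpow_sub (a : ℝ) {r : ℝ} (hr : 0 < r) (m : ℕ) :
    (r ^ 2) ^ (a - m) = (r ^ 2) ^ a * (r ^ (2 * m))⁻¹ := by
  rw [Real.rpow_sub (by positivity), Real.rpow_natCast, div_eq_mul_inv, pow_mul]

theorem IsCutoff.isRadialProfile (h : IsCutoff φ φ₁ φ₂ B c) (n : ℕ) :
    ∃ (A : ℝ) (g₂ : ℝ → ℝ), IsRadialProfile n A (rieszProfile n φ) (rieszProfileDeriv n φ φ₁) g₂ := by
  set a : ℝ := -((n : ℝ) + 1) / 2 with ha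
  have hB : 0 ≤ B := (mul_nonneg zero_le_one (h.deriv_nonneg 1)).trans (h.deriv_le 1 one_pos)
  set b : ℝ := |a| with hb
  set b' : ℝ := |a - 1| with hb'
  have hb0 : 0 ≤ b := abs_nonneg a
  have hb'0 : 0 ≤ b' := abs_nonneg _
  have hbB := mul_nonneg hb0 hB
  have hbb := mul_nonneg hb0 hb'0
  obtain ⟨K, hK⟩ : ∃ K, K = 1 + B + 2 * b * B + b + b * b' := ⟨_, rfl⟩
  have hK0 : 1 ≤ K := by linarith
  have hK1 : B + b ≤ K := by linarith
  have hK2 : B + 2 * b * B + b * b' ≤ K := by linarith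
  set A : ℝ := 3 ^ (n + 5) * K with hA
  refine ⟨A, fun t => φ₂ t * t ^ a + φ₁ t * (a * t ^ (a - 1)) +
    (φ₁ t * (a * t ^ (a - 1)) + φ t * (a * ((a - 1) * t ^ (a - 2)))), ?_, ?_, by positivity,
    ?_, ?_, ?_⟩
  · intro t
    by_cases ht : t < 1 / 4
    · have : rieszProfile n φ =ᶠ[nhds t] fun _ => 0 := by
        filter_upwards [Iio_mem_nhds ht] with s hs
        simp [rieszProfile, (h.eq_zero s hs).1]
      have h2 := (hasDerivAt_const t (0 : ℝ)).congr_of_eventuallyEq this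
      simpa [rieszProfileDeriv, (h.eq_zero t ht).1, (h.eq_zero t ht).2.1] using h2
    · have ht0 : t ≠ 0 := by linarith
      exact (h.hasDerivAt t).mul (Real.hasDerivAt_rpow_const (Or.inl ht0))
  · intro t
    by_cases ht : t < 1 / 4
    · have : rieszProfileDeriv n φ φ₁ =ᶠ[nhds t] fun _ => 0 := by
        filter_upwards [Iio_mem_nhds ht] with s hs
        simp [rieszProfileDeriv, (h.eq_zero s hs).1, (h.eq_zero s hs).2.1]
      have h2 := (hasDerivAt_const t (0 : ℝ)).congr_of_eventuallyEq this
      simpa [(h.eq_zero t ht).1, (h.eq_zero t ht).2.1, (h.eq_zero t ht).2.2] using h2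
    · have ht0 : t ≠ 0 := by linarith
      have e : a - 1 - 1 = a - 2 := by ring
      have h3 := (Real.hasDerivAt_rpow_const (x := t) (p := a - 1) (Or.inl ht0)).const_mul a
      rw [e] at h3
      exact ((h.hasDerivAt' t).mul (Real.hasDerivAt_rpow_const (Or.inl ht0))).add
        ((h.hasDerivAt t).mul h3)
  all_goals
    intro r hr
    by_cases hr2 : r < 1 / 2
    · have hz := h.eq_zero (r ^ 2) (by nlinarith)
      simp only [rieszProfile, rieszProfileDeriv, hz.1, hz.2.1, hz.2.2, zero_mul, add_zero,
        abs_zero]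
      positivity
    push Not at hr2
    have hr0 : 0 < r := by linarith
    have hφ : |φ (r ^ 2)| ≤ 1 := by rw [abs_of_nonneg (h.nonneg _)]; exact h.le_one _
    have hφ₁ : |φ₁ (r ^ 2)| * r ^ 2 ≤ B := by
      rw [abs_of_nonneg (h.deriv_nonneg _), mul_comm]; exact h.deriv_le _ (by positivity)
    have hφ₂ : |φ₂ (r ^ 2)| * r ^ 4 ≤ B := by
      have := h.deriv2_le (r ^ 2) (by positivity)
      nlinarith
    have e0 : (r ^ 2) ^ a = (r ^ (n + 1))⁻¹ := sq_rpow_neg_half n hr0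
    have e1 : (r ^ 2) ^ (a - 1) = (r ^ (n + 3))⁻¹ := by
      have := sq_rpow_sub a hr0 1
      rw [e0, Nat.cast_one, ← mul_inv, ← pow_add] at this
      exact this
    have e2 : (r ^ 2) ^ (a - 2) = (r ^ (n + 5))⁻¹ := by
      have := sq_rpow_sub a hr0 2
      rw [e0, Nat.cast_ofNat, ← mul_inv, ← pow_add] at this
      exact this
  · have hi := inv_pow_le_of_half_le hr2 (n + 1)
    rw [rieszProfile, ← ha, e0, abs_mul, abs_of_pos (a := (r ^ (n + 1))⁻¹) (by positivity)]
    calc |φ (r ^ 2)| * (r ^ (n + 1))⁻¹ ≤ 1 * (3 ^ (n + 1) / (1 + r) ^ (n + 1)) := by gcongr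
      _ = 3 ^ (n + 1) * 1 / (1 + r) ^ (n + 1) := by ring
      _ ≤ A / (1 + r) ^ (n + 1) := by
        rw [hA]
        gcongr
        · norm_num
        · omega
  · have hi := inv_pow_le_of_half_le hr2 (n + 3)
    rw [rieszProfileDeriv, ← ha, e0, e1]
    have e3 : (r ^ (n + 1))⁻¹ = r ^ 2 * (r ^ (n + 3))⁻¹ := by
      field_simp; ring
    calc _ ≤ |φ₁ (r ^ 2) * (r ^ (n + 1))⁻¹| + |φ (r ^ 2) * (a * (r ^ (n + 3))⁻¹)| := abs_add_le _ _
      _ = (|φ₁ (r ^ 2)| * r ^ 2 + |φ (r ^ 2)| * b) * (r ^ (n + 3))⁻¹ := by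
        rw [e3]
        simp only [abs_mul, abs_inv, abs_pow, abs_of_pos hr0]
        ring
      _ ≤ (B + 1 * b) * (3 ^ (n + 3) / (1 + r) ^ (n + 3)) := by gcongr
      _ = 3 ^ (n + 3) * (B + b) / (1 + r) ^ (n + 3) := by ring
      _ ≤ A / (1 + r) ^ (n + 3) := by
        rw [hA]
        gcongr
        · norm_num
        · omega
  · have hi := inv_pow_le_of_half_le hr2 (n + 5)
    rw [e0, e1, e2]
    have e3 : (r ^ (n + 1))⁻¹ = r ^ 4 * (r ^ (n + 5))⁻¹ := by
      field_simp; ring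
    have e4 : (r ^ (n + 3))⁻¹ = r ^ 2 * (r ^ (n + 5))⁻¹ := by
      field_simp; ring
    calc _ ≤ |φ₂ (r ^ 2) * (r ^ (n + 1))⁻¹| + |φ₁ (r ^ 2) * (a * (r ^ (n + 3))⁻¹)| +
          (|φ₁ (r ^ 2) * (a * (r ^ (n + 3))⁻¹)| +
            |φ (r ^ 2) * (a * ((a - 1) * (r ^ (n + 5))⁻¹))|) :=
          (abs_add_le _ _).trans (add_le_add (abs_add_le _ _) (abs_add_le _ _))
      _ = (|φ₂ (r ^ 2)| * r ^ 4 + 2 * b * (|φ₁ (r ^ 2)| * r ^ 2) + |φ (r ^ 2)| * (b * b')) *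
          (r ^ (n + 5))⁻¹ := by
        rw [e3, e4]
        simp only [abs_mul, abs_inv, abs_pow, abs_of_pos hr0]
        ring
      _ ≤ (B + 2 * b * B + 1 * (b * b')) * (3 ^ (n + 5) / (1 + r) ^ (n + 5)) := by gcongr
      _ = 3 ^ (n + 5) * (B + 2 * b * B + b * b') / (1 + r) ^ (n + 5) := by ring
      _ ≤ A / (1 + r) ^ (n + 5) := by
        rw [hA]
        gcongr

/-- The trace, over any `(n+1)`-dimensional subspace, of the differential of the truncated Riesz
kernel, expressed through `s = |Πw|²`, is non-negative: this uses `φ' ≥ 0` and `s ≤ |w|²`. -/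
theorem IsCutoff.trace_nonneg (h : IsCutoff φ φ₁ φ₂ B c) (n : ℕ) {r s : ℝ} (hr : 0 ≤ r)
    (hs : 0 ≤ s) (hsr : s ≤ r ^ 2) :
    0 ≤ (n + 1) * rieszProfile n φ (r ^ 2) + 2 * rieszProfileDeriv n φ φ₁ (r ^ 2) * s := by
  by_cases hr2 : r < 1 / 2
  · have hz := h.eq_zero (r ^ 2) (by nlinarith)
    simp [rieszProfile, rieszProfileDeriv, hz.1, hz.2.1]
  push Not at hr2
  have hr0 : 0 < r := by linarith
  have e1 := sq_rpow_sub (-((n : ℝ) + 1) / 2) hr0 1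
  rw [Nat.cast_one] at e1
  rw [rieszProfile, rieszProfileDeriv, e1, sq_rpow_neg_half n hr0]
  have h0 := h.nonneg (r ^ 2)
  have h1 := h.deriv_nonneg (r ^ 2)
  have h3 : 0 ≤ 1 - s * (r ^ 2)⁻¹ := by
    rw [sub_nonneg, ← div_eq_mul_inv, div_le_one (by positivity)]; exact hsr
  have : ((n : ℝ) + 1) * (φ (r ^ 2) * (r ^ (n + 1))⁻¹) + 2 * (φ₁ (r ^ 2) * (r ^ (n + 1))⁻¹ +
      φ (r ^ 2) * (-((n : ℝ) + 1) / 2 * ((r ^ (n + 1))⁻¹ * (r ^ (2 * 1))⁻¹))) * s =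
      (r ^ (n + 1))⁻¹ * ((n + 1) * φ (r ^ 2) * (1 - s * (r ^ 2)⁻¹) + 2 * φ₁ (r ^ 2) * s) := by
    rw [mul_one]; ring
  rw [this]
  positivity

/-- On the annulus `3/4 ≤ |w| ≤ 3/2` the trace in `IsCutoff.trace_nonneg` is bounded below: either
`w` is far from the subspace and the first term is large, or `s` is comparable to `|w|²` and the
term with `φ'` is large. -/
theorem IsCutoff.trace_lower (h : IsCutoff φ φ₁ φ₂ B c) (n : ℕ) {r s : ℝ}
    (hr : r ∈ Icc (3 / 4 : ℝ) (3 / 2)) (hs : 0 ≤ s) (hsr : s ≤ r ^ 2) :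
    (2 ^ (n + 1))⁻¹ * c ≤
      (n + 1) * rieszProfile n φ (r ^ 2) + 2 * rieszProfileDeriv n φ φ₁ (r ^ 2) * s := by
  have hr0 : 0 < r := by linarith [hr.1]
  have e1 := sq_rpow_sub (-((n : ℝ) + 1) / 2) hr0 1
  rw [Nat.cast_one] at e1
  rw [rieszProfile, rieszProfileDeriv, e1, sq_rpow_neg_half n hr0]
  have hlow := h.lower (r ^ 2) ⟨by nlinarith [hr.1], by nlinarith [hr.2, hr0]⟩
  have hc := h.c_pos
  set q := s * (r ^ 2)⁻¹ with hq
  have hq0 : 0 ≤ q := by positivity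
  have hq1 : q ≤ 1 := by rw [hq, ← div_eq_mul_inv, div_le_one (by positivity)]; exact hsr
  have hsq : s = q * r ^ 2 := by rw [hq]; field_simp
  have : ((n : ℝ) + 1) * (φ (r ^ 2) * (r ^ (n + 1))⁻¹) + 2 * (φ₁ (r ^ 2) * (r ^ (n + 1))⁻¹ +
      φ (r ^ 2) * (-((n : ℝ) + 1) / 2 * ((r ^ (n + 1))⁻¹ * (r ^ (2 * 1))⁻¹))) * s =
      (r ^ (n + 1))⁻¹ * ((n + 1) * φ (r ^ 2) * (1 - q) + 2 * φ₁ (r ^ 2) * s) := by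
    rw [mul_one, hq]; ring
  rw [this]
  have hinv : ((2 : ℝ) ^ (n + 1))⁻¹ ≤ (r ^ (n + 1))⁻¹ :=
    inv_anti₀ (by positivity) (pow_le_pow_left₀ hr0.le (by linarith [hr.2]) _)
  refine mul_le_mul hinv ?_ hc.le (by positivity)
  have t1 : c * (1 - q) ≤ (n + 1) * φ (r ^ 2) * (1 - q) := by
    refine mul_le_mul_of_nonneg_right ?_ (by linarith)
    nlinarith [hlow.1, (Nat.cast_nonneg n : (0 : ℝ) ≤ n)]
  have t2 : c * q ≤ 2 * φ₁ (r ^ 2) * s := by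
    have : (9 / 16 : ℝ) ≤ r ^ 2 := by nlinarith [hr.1]
    rw [hsq]
    have h3 : c ≤ 2 * φ₁ (r ^ 2) * r ^ 2 := by nlinarith [hlow.2]
    nlinarith
  linarith

end RieszProfile

/-! ### Integration against regular measures -/

section Regular

variable {n d : ℕ} {C : ℝ} {μ : Measure (EuclideanSpace ℝ (Fin d))}

theorem IsADRegular.measure_closedBall_le (h : IsADRegular n C μ) (htop : Metric.ediam μ.support = ⊤)
    {x : EuclideanSpace ℝ (Fin d)} (hx : x ∈ μ.support) {r : ℝ} (hr : 0 < r) :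
    μ (Metric.closedBall x r) ≤ ENNReal.ofReal (C * r ^ n) :=
  h.upper x hx r hr (by rw [htop]; exact le_top)

theorem IsADRegular.measure_closedBall_lt_top (h : IsADRegular n C μ)
    (htop : Metric.ediam μ.support = ⊤)
    {x : EuclideanSpace ℝ (Fin d)} (hx : x ∈ μ.support) {r : ℝ} (hr : 0 < r) :
    μ (Metric.closedBall x r) < ⊤ :=
  (h.measure_closedBall_le htop hx hr).trans_lt ENNReal.ofReal_lt_top

theorem IsADRegular.measureReal_closedBall_le (h : IsADRegular n C μ)
    (htop : Metric.ediam μ.support = ⊤)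
    {x : EuclideanSpace ℝ (Fin d)} (hx : x ∈ μ.support) {r : ℝ} (hr : 0 < r) :
    μ.real (Metric.closedBall x r) ≤ C * r ^ n := by
  have := h.const_pos
  exact ENNReal.toReal_le_of_le_ofReal (by positivity) (h.measure_closedBall_le htop hx hr)

theorem IsADRegular.le_measureReal_closedBall (h : IsADRegular n C μ)
    (htop : Metric.ediam μ.support = ⊤)
    {x : EuclideanSpace ℝ (Fin d)} (hx : x ∈ μ.support) {r : ℝ} (hr : 0 < r) :
    C⁻¹ * r ^ n ≤ μ.real (Metric.closedBall x r) :=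
  (ENNReal.ofReal_le_iff_le_toReal (h.measure_closedBall_lt_top htop hx hr).ne).1
    (h.lower x hx r hr (by rw [htop]; exact le_top))

theorem norm_inv_smul_sub_le_iff {ε : ℝ} (hε : 0 < ε) (x y : EuclideanSpace ℝ (Fin d)) (u : ℝ) :
    ‖ε⁻¹ • (x - y)‖ ≤ u ↔ y ∈ Metric.closedBall x (u * ε) := by
  rw [mem_closedBall_iff_norm', norm_smul, norm_inv, Real.norm_eq_abs, abs_of_pos hε,
    inv_mul_le_iff₀ hε, mul_comm]

/-- The decay `(1 + |x - y| / ε)^{-(n+1)}` is integrable with integral `O(εⁿ)`: sum the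
contributions of the balls of radius `2ᵏ ε`. -/
theorem IsADRegular.lintegral_decay_le (h : IsADRegular n C μ) (htop : Metric.ediam μ.support = ⊤)
    {x : EuclideanSpace ℝ (Fin d)} (hx : x ∈ μ.support) {ε : ℝ} (hε : 0 < ε) :
    ∫⁻ y, ENNReal.ofReal (1 / (1 + ‖ε⁻¹ • (x - y)‖) ^ (n + 1)) ∂μ ≤
      ENNReal.ofReal (2 ^ (n + 1) * C * ε ^ n) := by
  have hC := h.const_pos
  let a : ℕ → ENNReal := fun m => ENNReal.ofReal ((((2 : ℝ) ^ m) ^ (n + 1))⁻¹)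
  let F : ℕ → EuclideanSpace ℝ (Fin d) → ENNReal := fun m =>
    (Metric.closedBall x (2 ^ (m + 1) * ε)).indicator fun _ => a m
  have hpt : ∀ y, ENNReal.ofReal (1 / (1 + ‖ε⁻¹ • (x - y)‖) ^ (n + 1)) ≤ ∑' m, F m y := by
    intro y
    set u := ‖ε⁻¹ • (x - y)‖ with hu
    have hu0 : 0 ≤ u := norm_nonneg _
    obtain ⟨m, hm1, hm2⟩ := exists_nat_pow_near (x := 1 + u) (y := 2) (by linarith) one_lt_two
    refine le_trans ?_ (ENNReal.le_tsum m)
    have hmem : y ∈ Metric.closedBall x (2 ^ (m + 1) * ε) :=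
      (norm_inv_smul_sub_le_iff hε x y _).1 (by linarith)
    simp only [F, indicator_of_mem hmem, a]
    refine ENNReal.ofReal_le_ofReal ?_
    rw [one_div]
    exact inv_anti₀ (by positivity) (pow_le_pow_left₀ (by positivity) hm1 _)
  have hint : ∀ m, ∫⁻ y, F m y ∂μ ≤ ENNReal.ofReal (2 ^ n * C * ε ^ n * (1 / 2) ^ m) := by
    intro m
    rw [lintegral_indicator_const Metric.isClosed_closedBall.measurableSet]
    calc _ ≤ a m * ENNReal.ofReal (C * (2 ^ (m + 1) * ε) ^ n) := by
          gcongr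
          exact h.measure_closedBall_le htop hx (by positivity)
      _ = _ := by
          rw [← ENNReal.ofReal_mul (by positivity)]
          congr 1
          have : ((2 : ℝ) ^ m) ^ n ≠ 0 := by positivity
          rw [mul_pow, pow_succ 2 m, mul_pow, pow_succ _ n, one_div, inv_pow]
          field_simp
  calc _ ≤ ∫⁻ y, ∑' m, F m y ∂μ := lintegral_mono hpt
    _ = ∑' m, ∫⁻ y, F m y ∂μ := lintegral_tsum fun m =>
        (measurable_const.indicator Metric.isClosed_closedBall.measurableSet).aemeasurable
    _ ≤ ∑' m, ENNReal.ofReal (2 ^ n * C * ε ^ n * (1 / 2) ^ m) := ENNReal.tsum_le_tsum hint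
    _ = ENNReal.ofReal (2 ^ (n + 1) * C * ε ^ n) := by
        rw [← ENNReal.ofReal_tsum_of_nonneg (fun m => by positivity)
          (summable_geometric_two.mul_left _), tsum_mul_left, tsum_geometric_two]
        congr 1
        ring

theorem continuous_decay (ε : ℝ) (x : EuclideanSpace ℝ (Fin d)) (m : ℕ) :
    Continuous fun y : EuclideanSpace ℝ (Fin d) => 1 / (1 + ‖ε⁻¹ • (x - y)‖) ^ m := by
  refine continuous_const.div (by fun_prop) fun y => ?_
  positivity

theorem IsADRegular.integrable_decay (h : IsADRegular n C μ) (htop : Metric.ediam μ.support = ⊤)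
    {x : EuclideanSpace ℝ (Fin d)} (hx : x ∈ μ.support) {ε : ℝ} (hε : 0 < ε) :
    Integrable (fun y => 1 / (1 + ‖ε⁻¹ • (x - y)‖) ^ (n + 1)) μ := by
  refine ⟨(continuous_decay ε x _).aestronglyMeasurable, ?_⟩
  rw [hasFiniteIntegral_iff_ofReal (ae_of_all _ fun y => by positivity)]
  exact (h.lintegral_decay_le htop hx hε).trans_lt ENNReal.ofReal_lt_top

theorem IsADRegular.integral_decay_le (h : IsADRegular n C μ) (htop : Metric.ediam μ.support = ⊤)
    {x : EuclideanSpace ℝ (Fin d)} (hx : x ∈ μ.support) {ε : ℝ} (hε : 0 < ε) :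
    ∫ y, 1 / (1 + ‖ε⁻¹ • (x - y)‖) ^ (n + 1) ∂μ ≤ 2 ^ (n + 1) * C * ε ^ n := by
  have hC := h.const_pos
  rw [integral_eq_lintegral_of_nonneg_ae (ae_of_all _ fun y => by positivity)
    (continuous_decay ε x _).aestronglyMeasurable]
  exact ENNReal.toReal_le_of_le_ofReal (by positivity) (h.lintegral_decay_le htop hx hε)

/-- A function dominated by `a (1 + |x - y| / ε)^{-(n+1)}` is integrable, with integral at most
`2^{n+1} C a` after normalization by `ε^{-n}`. -/
theorem IsADRegular.integrable_of_norm_le_decay {F : Type*} [NormedAddCommGroup F]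
    [NormedSpace ℝ F] (h : IsADRegular n C μ)
    (htop : Metric.ediam μ.support = ⊤) {x : EuclideanSpace ℝ (Fin d)} (hx : x ∈ μ.support)
    {ε : ℝ} (hε : 0 < ε) {f : EuclideanSpace ℝ (Fin d) → F} {a : ℝ} (ha : 0 ≤ a)
    (hf : AEStronglyMeasurable f μ)
    (hle : ∀ y, ‖f y‖ ≤ a / (1 + ‖ε⁻¹ • (x - y)‖) ^ (n + 1)) :
    Integrable f μ ∧ (ε ^ n)⁻¹ * ‖∫ y, f y ∂μ‖ ≤ 2 ^ (n + 1) * C * a := by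
  have hint := (h.integrable_decay htop hx hε).const_mul a
  have hle' : ∀ y, ‖f y‖ ≤ a * (1 / (1 + ‖ε⁻¹ • (x - y)‖) ^ (n + 1)) := fun y => by
    rw [mul_one_div]; exact hle y
  refine ⟨hint.mono' hf (ae_of_all _ hle'), ?_⟩
  have h1 := norm_integral_le_of_norm_le hint (ae_of_all μ hle')
  rw [integral_const_mul] at h1
  rw [inv_mul_le_iff₀ (by positivity)]
  calc _ ≤ a * (2 ^ (n + 1) * C * ε ^ n) :=
        h1.trans (mul_le_mul_of_nonneg_left (h.integral_decay_le htop hx hε) ha)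
    _ = _ := by ring

/-- Among the first `J` dyadic annuli around a point of the support, one carries a mass comparable
to that of a ball, once `2 ^ J` is large in terms of the regularity constant. -/
theorem IsADRegular.exists_annulus (h : IsADRegular n C μ) (hn : 1 ≤ n)
    (htop : Metric.ediam μ.support = ⊤) {x : EuclideanSpace ℝ (Fin d)} (hx : x ∈ μ.support)
    {J : ℕ} (hJ : C * (C + 1) ≤ 2 ^ J) {ρ : ℝ} (hρ : 0 < ρ) :
    ∃ j < J, ρ ^ n / J ≤ μ.real (Metric.closedBall x (2 ^ (j + 1) * ρ) \
      Metric.closedBall x (2 ^ j * ρ)) := by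
  have hC := h.const_pos
  let f : ℕ → ℝ := fun j => μ.real (Metric.closedBall x (2 ^ j * ρ))
  have hdiff : ∀ j, μ.real (Metric.closedBall x (2 ^ (j + 1) * ρ) \
      Metric.closedBall x (2 ^ j * ρ)) = f (j + 1) - f j := by
    intro j
    refine measureReal_sdiff (Metric.closedBall_subset_closedBall ?_)
      Metric.isClosed_closedBall.measurableSet
      (h.measure_closedBall_lt_top htop hx (by positivity)).ne
    gcongr
    · norm_num
    · omega
  have hJ0 : J ≠ 0 := by
    rintro rfl
    -- `C⁻¹ rⁿ ≤ μ(B(x, r)) ≤ C rⁿ` forces `1 ≤ C`.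
    have h1 := (h.le_measureReal_closedBall htop hx one_pos).trans
      (h.measureReal_closedBall_le htop hx one_pos)
    rw [one_pow, mul_one, mul_one, inv_le_iff_one_le_mul₀ hC] at h1
    rw [pow_zero] at hJ
    nlinarith
  have hf0 : f 0 ≤ C * ρ ^ n := by
    simpa [f] using h.measureReal_closedBall_le htop hx hρ
  have hfJ : (C + 1) * ρ ^ n ≤ f J := by
    refine le_trans ?_ (h.le_measureReal_closedBall htop hx (by positivity))
    rw [mul_pow, ← mul_assoc]
    gcongr
    rw [le_inv_mul_iff₀ hC]
    exact hJ.trans (le_self_pow₀ (one_le_pow₀ one_le_two) (by omega))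
  have hsum : ∑ j ∈ Finset.range J, (ρ ^ n / J) ≤ ∑ j ∈ Finset.range J, (f (j + 1) - f j) := by
    rw [Finset.sum_range_sub, Finset.sum_const, Finset.card_range, nsmul_eq_mul,
      mul_div_cancel₀ _ (by exact_mod_cast hJ0)]
    linarith
  obtain ⟨j, hj, hle⟩ := Finset.exists_le_of_sum_le (by simpa using hJ0) hsum
  exact ⟨j, Finset.mem_range.1 hj, by rw [hdiff]; exact hle⟩

end Regular

/-! ### Orthonormal families from points far from planes -/

section FarPoints

theorem Submodule.exists_le_finrank_eq {K V : Type*} [Field K] [AddCommGroup V] [Module K V]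
    [FiniteDimensional K V] (W : Submodule K V) {n : ℕ} (hW : Module.finrank K W ≤ n)
    (hn : n ≤ Module.finrank K V) :
    ∃ W' : Submodule K V, W ≤ W' ∧ Module.finrank K W' = n := by
  induction n, hW using Nat.le_induction with
  | base => exact ⟨W, le_rfl, rfl⟩
  | succ m hm ih =>
    obtain ⟨W', hle, hrank⟩ := ih (by omega)
    have hne : W' ≠ ⊤ := by
      rintro rfl
      rw [finrank_top] at hrank
      omega
    obtain ⟨v, -, hv⟩ := SetLike.exists_of_lt hne.lt_top
    exact ⟨W' ⊔ K ∙ v, hle.trans le_sup_left, by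
      rw [Submodule.finrank_sup_span_singleton hv, hrank]⟩

/-- If a linear map `T` is at most `τ` on a bounded set `S` which contains, for every `n`-plane
through the origin, a point at distance at least `η` from it, then `T` is `O(τ)` on some
orthonormal family of `n + 1` vectors. The family is produced by a quantitative Gram–Schmidt
process, and the constant depends only on `n` and `η`. -/
theorem exists_orthonormal_norm_map_le (n : ℕ) {η : ℝ} (hη : 0 < η) (k : ℕ) (hk : k ≤ n + 1) :
    ∃ M : ℝ, 0 < M ∧ ∀ (E : Type) [NormedAddCommGroup E] [InnerProductSpace ℝ E]
      [FiniteDimensional ℝ E], n ≤ Module.finrank ℝ E → ∀ (T : E →L[ℝ] E) (τ : ℝ), 0 ≤ τ →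
      ∀ S : Set E, (∀ v ∈ S, ‖v‖ ≤ 2 ∧ ‖T v‖ ≤ τ) →
      (∀ W : Submodule ℝ E, Module.finrank ℝ W = n → ∃ v ∈ S, ∀ w ∈ W, η ≤ ‖v - w‖) →
      ∃ e : Fin k → E, Orthonormal ℝ e ∧ ∀ i, ‖T (e i)‖ ≤ M * τ := by
  induction k with
  | zero =>
    refine ⟨1, one_pos, fun E _ _ _ _ T τ _ S _ _ => ⟨Fin.elim0, ?_, fun i => i.elim0⟩⟩
    exact ⟨fun i => i.elim0, fun i => i.elim0⟩
  | succ k ih =>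
    obtain ⟨M, hM, ih⟩ := ih (by omega)
    refine ⟨M + (1 + k * (2 * M)) / η, by positivity, ?_⟩
    intro E _ _ _ hn T τ hτ S hS hfar
    obtain ⟨e, he, hTe⟩ := ih E hn T τ hτ S hS hfar
    have hrank : Module.finrank ℝ (Submodule.span ℝ (range e)) = k := by
      rw [finrank_span_eq_card he.linearIndependent, Fintype.card_fin]
    obtain ⟨W, hW, hWn⟩ := Submodule.exists_le_finrank_eq (Submodule.span ℝ (range e))
      (n := n) (by omega) hn
    obtain ⟨v, hvS, hv⟩ := hfar W hWn
    set p : E := ∑ i, inner ℝ (e i) v • e i with hp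
    have hpW : p ∈ W := hW (Submodule.sum_mem _ fun i _ =>
      Submodule.smul_mem _ _ (Submodule.subset_span (mem_range_self i)))
    set f : E := v - p with hf
    have hfη : η ≤ ‖f‖ := hv p hpW
    have hf0 : 0 < ‖f‖ := hη.trans_le hfη
    have horth : ∀ i, inner ℝ f (e i) = 0 := by
      intro i
      rw [real_inner_comm, hf, inner_sub_right, hp, he.inner_right_fintype, sub_self]
    have hTf : ‖T f‖ ≤ τ + k * (2 * (M * τ)) := by
      rw [hf, map_sub, hp, map_sum]
      refine (norm_sub_le _ _).trans (add_le_add (hS v hvS).2 ?_)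
      refine (norm_sum_le _ _).trans ?_
      calc _ ≤ ∑ _i : Fin k, 2 * (M * τ) := by
            refine Finset.sum_le_sum fun i _ => ?_
            rw [map_smul, norm_smul]
            refine mul_le_mul ?_ (hTe i) (norm_nonneg _) (by norm_num)
            refine (norm_inner_le_norm _ _).trans ?_
            rw [he.1 i, one_mul]
            exact (hS v hvS).1
        _ = _ := by simp
    refine ⟨Matrix.vecCons (‖f‖⁻¹ • f) e, orthonormal_vecCons_iff.2 ⟨?_, ?_, he⟩, ?_⟩
    · rw [norm_smul, norm_inv, norm_norm, inv_mul_cancel₀ hf0.ne']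
    · intro i
      rw [inner_smul_left, horth i, mul_zero]
    · intro i
      refine Fin.cases ?_ (fun i => ?_) i
      · rw [Matrix.cons_val_zero, map_smul, norm_smul, norm_inv, norm_norm]
        calc ‖f‖⁻¹ * ‖T f‖ ≤ η⁻¹ * (τ + k * (2 * (M * τ))) := by gcongr
          _ = (1 + k * (2 * M)) / η * τ := by rw [div_eq_mul_inv]; ring
          _ ≤ (M + (1 + k * (2 * M)) / η) * τ := by
            gcongr
            linarith
      · rw [Matrix.cons_val_succ]
        refine (hTe i).trans ?_
        gcongr
        have : 0 ≤ (1 + k * (2 * M)) / η := by positivity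
        linarith

end FarPoints

/-! ### Truncated Riesz transforms and their linearization -/

section ScaledKernel

variable {n d : ℕ} {A B c C : ℝ} {g g₁ g₂ φ φ₁ φ₂ : ℝ → ℝ}
  {μ : Measure (EuclideanSpace ℝ (Fin d))}

/-- The rescaled kernel `z ↦ ε⁻ⁿ k(z / ε)` for `k = radialField g`. -/
noncomputable def scaledKernel (n : ℕ) {d : ℕ} (g : ℝ → ℝ) (ε : ℝ)
    (z : EuclideanSpace ℝ (Fin d)) : EuclideanSpace ℝ (Fin d) :=
  (ε ^ n)⁻¹ • radialField g (ε⁻¹ • z)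

/-- The linearization at `x` of the transform with kernel `scaledKernel n g ε`, acting on
increments measured in units of `ε`. -/
noncomputable def linearizedTransform (n : ℕ) {d : ℕ} (g g₁ : ℝ → ℝ)
    (μ : Measure (EuclideanSpace ℝ (Fin d))) (ε : ℝ) (x : EuclideanSpace ℝ (Fin d)) :
    EuclideanSpace ℝ (Fin d) →L[ℝ] EuclideanSpace ℝ (Fin d) :=
  (ε ^ n)⁻¹ • ∫ y, radialFieldDeriv g g₁ (ε⁻¹ • (x - y)) ∂μ

theorem IsRadialProfile.continuous_scaledKernel (hg : IsRadialProfile n A g g₁ g₂) (ε : ℝ) :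
    Continuous (scaledKernel n g ε : EuclideanSpace ℝ (Fin d) → EuclideanSpace ℝ (Fin d)) :=
  (hg.continuous_radialField.comp (continuous_const_smul ε⁻¹)).const_smul (ε ^ n)⁻¹

theorem scaledKernel_sub_eq (ε : ℝ) (x x₀ y : EuclideanSpace ℝ (Fin d)) :
    scaledKernel n g ε (x - y) - scaledKernel n g ε (x₀ - y) =
      (ε ^ n)⁻¹ • (radialField g (ε⁻¹ • (x₀ - y) + ε⁻¹ • (x - x₀)) -
        radialField g (ε⁻¹ • (x₀ - y))) := by
  rw [scaledKernel, scaledKernel, ← smul_sub, ← smul_add]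
  congr 4
  abel

theorem norm_inv_smul_le_half {ε : ℝ} (hε : 0 < ε) {v : EuclideanSpace ℝ (Fin d)}
    (hv : ‖v‖ ≤ ε / 2) : ‖ε⁻¹ • v‖ ≤ 1 / 2 := by
  rw [norm_smul, norm_inv, Real.norm_eq_abs, abs_of_pos hε, inv_mul_le_iff₀ hε]
  linarith

theorem norm_inv_smul {ε : ℝ} (hε : 0 < ε) (v : EuclideanSpace ℝ (Fin d)) :
    ‖ε⁻¹ • v‖ = ‖v‖ / ε := by
  rw [norm_smul, norm_inv, Real.norm_eq_abs, abs_of_pos hε, inv_mul_eq_div]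

/-- The transform with kernel `scaledKernel n g ε` has Lipschitz constant `O(1 / ε)`. Its
increments converge absolutely, even though the transform itself need not. -/
theorem IsADRegular.norm_integral_scaledKernel_sub_le (h : IsADRegular n C μ)
    (htop : Metric.ediam μ.support = ⊤) (hg : IsRadialProfile n A g g₁ g₂) {ε : ℝ} (hε : 0 < ε)
    {x₀ x : EuclideanSpace ℝ (Fin d)} (hx₀ : x₀ ∈ μ.support) (hx : ‖x - x₀‖ ≤ ε / 2) :
    Integrable (fun y => scaledKernel n g ε (x - y) - scaledKernel n g ε (x₀ - y)) μ ∧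
      ‖∫ y, (scaledKernel n g ε (x - y) - scaledKernel n g ε (x₀ - y)) ∂μ‖ ≤
        2 ^ (n + 1) * C * (2 ^ (n + 1) * (3 * A)) * (‖x - x₀‖ / ε) := by
  have hA := hg.pos
  have hcont : Continuous fun y => radialField g (ε⁻¹ • (x₀ - y) + ε⁻¹ • (x - x₀)) -
      radialField g (ε⁻¹ • (x₀ - y)) := by
    have := hg.continuous_radialField (E := EuclideanSpace ℝ (Fin d))
    fun_prop
  obtain ⟨hi, hle⟩ := h.integrable_of_norm_le_decay htop hx₀ hε
    (a := 2 ^ (n + 1) * (3 * A) * (‖x - x₀‖ / ε)) (by positivity) hcont.aestronglyMeasurable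
    (fun y => by
      refine (hg.norm_radialField_sub_le _ _ (norm_inv_smul_le_half hε hx)).trans_eq ?_
      rw [norm_inv_smul hε (x - x₀)]
      ring)
  simp only [scaledKernel_sub_eq]
  refine ⟨hi.fun_smul _, ?_⟩
  rw [integral_smul, norm_smul, norm_inv, norm_pow, Real.norm_eq_abs, abs_of_pos hε]
  exact hle.trans_eq (by ring)

theorem IsADRegular.integrable_radialFieldDeriv (h : IsADRegular n C μ)
    (htop : Metric.ediam μ.support = ⊤) (hg : IsRadialProfile n A g g₁ g₂) {ε : ℝ} (hε : 0 < ε)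
    {x₀ : EuclideanSpace ℝ (Fin d)} (hx₀ : x₀ ∈ μ.support) :
    Integrable (fun y => radialFieldDeriv g g₁ (ε⁻¹ • (x₀ - y))) μ := by
  have hA := hg.pos
  have hcont : Continuous fun y => radialFieldDeriv g g₁ (ε⁻¹ • (x₀ - y)) := by
    have := hg.continuous_radialFieldDeriv (E := EuclideanSpace ℝ (Fin d))
    exact this.comp (by fun_prop)
  exact (h.integrable_of_norm_le_decay htop hx₀ hε (a := 3 * A) (by positivity)
    hcont.aestronglyMeasurable fun y => hg.norm_radialFieldDeriv_le _).1

/-- The increments of the transform agree with `linearizedTransform` up to a quadratic error. -/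
theorem IsADRegular.norm_integral_scaledKernel_sub_sub_le (h : IsADRegular n C μ)
    (htop : Metric.ediam μ.support = ⊤) (hg : IsRadialProfile n A g g₁ g₂) {ε : ℝ} (hε : 0 < ε)
    {x₀ x : EuclideanSpace ℝ (Fin d)} (hx₀ : x₀ ∈ μ.support) (hx : ‖x - x₀‖ ≤ ε / 2) :
    ‖∫ y, (scaledKernel n g ε (x - y) - scaledKernel n g ε (x₀ - y)) ∂μ -
        linearizedTransform n g g₁ μ ε x₀ (ε⁻¹ • (x - x₀))‖ ≤
      2 ^ (n + 1) * C * (2 ^ (n + 2) * (10 * A)) * (‖x - x₀‖ / ε) ^ 2 := by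
  have hA := hg.pos
  set v := ε⁻¹ • (x - x₀) with hv
  have hv2 : ‖v‖ ≤ 1 / 2 := norm_inv_smul_le_half hε hx
  have hD := h.integrable_radialFieldDeriv htop hg hε hx₀
  have hDv : Integrable (fun y => radialFieldDeriv g g₁ (ε⁻¹ • (x₀ - y)) v) μ :=
    hD.apply_continuousLinearMap v
  have hcont : Continuous fun y => radialField g (ε⁻¹ • (x₀ - y) + v) -
      radialField g (ε⁻¹ • (x₀ - y)) := by
    have := hg.continuous_radialField (E := EuclideanSpace ℝ (Fin d))
    fun_prop
  obtain ⟨hi, -⟩ := h.integrable_of_norm_le_decay htop hx₀ hε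
    (a := 2 ^ (n + 1) * (3 * A) * ‖v‖) (by positivity) hcont.aestronglyMeasurable
    (fun y => (hg.norm_radialField_sub_le _ _ hv2).trans_eq (by ring))
  obtain ⟨-, hle⟩ := h.integrable_of_norm_le_decay htop hx₀ hε
    (f := fun y => radialField g (ε⁻¹ • (x₀ - y) + v) - radialField g (ε⁻¹ • (x₀ - y)) -
      radialFieldDeriv g g₁ (ε⁻¹ • (x₀ - y)) v)
    (a := 2 ^ (n + 2) * (10 * A) * ‖v‖ ^ 2) (by positivity)
    (hi.sub hDv).aestronglyMeasurable
    (fun y => by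
      refine (hg.norm_radialField_sub_sub_le _ v hv2).trans ?_
      rw [div_mul_eq_mul_div]
      gcongr 2 ^ (n + 2) * (10 * A) * ‖v‖ ^ 2 / ?_
      exact pow_le_pow_right₀ (by linarith [norm_nonneg (ε⁻¹ • (x₀ - y))]) (by omega))
  have heq : ∫ y, (scaledKernel n g ε (x - y) - scaledKernel n g ε (x₀ - y)) ∂μ -
      linearizedTransform n g g₁ μ ε x₀ v = (ε ^ n)⁻¹ • ∫ y,
        (radialField g (ε⁻¹ • (x₀ - y) + v) - radialField g (ε⁻¹ • (x₀ - y)) -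
          radialFieldDeriv g g₁ (ε⁻¹ • (x₀ - y)) v) ∂μ := by
    simp only [scaledKernel_sub_eq]
    rw [integral_smul, linearizedTransform, smul_apply,
      ContinuousLinearMap.integral_apply hD, ← smul_sub, ← integral_sub hi hDv]
  rw [heq, norm_smul, norm_inv, norm_pow, Real.norm_eq_abs, abs_of_pos hε]
  refine hle.trans_eq ?_
  rw [hv, norm_inv_smul hε]
  ring

/-- The trace of the linearized transform over an `(n+1)`-dimensional subspace is bounded below by
the mass of an annulus of radius comparable to `ε`. -/
theorem IsADRegular.le_sum_inner_linearizedTransform (h : IsADRegular n C μ)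
    (htop : Metric.ediam μ.support = ⊤) (hφ : IsCutoff φ φ₁ φ₂ B c)
    (hg : IsRadialProfile n A (rieszProfile n φ) (rieszProfileDeriv n φ φ₁) g₂)
    {ε : ℝ} (hε : 0 < ε) {x : EuclideanSpace ℝ (Fin d)} (hx : x ∈ μ.support)
    {e : Fin (n + 1) → EuclideanSpace ℝ (Fin d)} (he : Orthonormal ℝ e) :
    (ε ^ n)⁻¹ * ((2 ^ (n + 1))⁻¹ * c * μ.real (Metric.closedBall x (3 / 2 * ε) \
        Metric.closedBall x (3 / 4 * ε))) ≤
      ∑ i, inner ℝ (e i) (linearizedTransform n (rieszProfile n φ) (rieszProfileDeriv n φ φ₁)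
        μ ε x (e i)) := by
  have hD := h.integrable_radialFieldDeriv htop hg hε hx
  set F : EuclideanSpace ℝ (Fin d) → ℝ := fun y => ∑ i, inner ℝ (e i)
    (radialFieldDeriv (rieszProfile n φ) (rieszProfileDeriv n φ φ₁) (ε⁻¹ • (x - y)) (e i)) with hF
  have hDi : ∀ i, Integrable (fun y => inner ℝ (e i) (radialFieldDeriv (rieszProfile n φ)
      (rieszProfileDeriv n φ φ₁) (ε⁻¹ • (x - y)) (e i))) μ := fun i =>
    (hD.apply_continuousLinearMap (e i)).const_inner (e i)
  have hFi : Integrable F μ := integrable_finsetSum _ fun i _ => hDi i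
  have heq : ∑ i, inner ℝ (e i) (linearizedTransform n (rieszProfile n φ)
      (rieszProfileDeriv n φ φ₁) μ ε x (e i)) = (ε ^ n)⁻¹ * ∫ y, F y ∂μ := by
    rw [hF, integral_finsetSum _ fun i _ => hDi i, Finset.mul_sum]
    refine Finset.sum_congr rfl fun i _ => ?_
    rw [linearizedTransform, smul_apply, inner_smul_right,
      ContinuousLinearMap.integral_apply hD, integral_inner (hD.apply_continuousLinearMap (e i))]
  have hbessel : ∀ w, ∑ i, inner ℝ (e i) w ^ 2 ≤ ‖w‖ ^ 2 := fun w => by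
    have := he.sum_inner_products_le w (s := Finset.univ)
    simpa using this
  have hFw : ∀ y, F y = (n + 1) * rieszProfile n φ (‖ε⁻¹ • (x - y)‖ ^ 2) +
      2 * rieszProfileDeriv n φ φ₁ (‖ε⁻¹ • (x - y)‖ ^ 2) *
        ∑ i, inner ℝ (e i) (ε⁻¹ • (x - y)) ^ 2 := fun y => by
    simp only [hF]
    rw [sum_inner_radialFieldDeriv _ _ _ he, Fintype.card_fin]
    push_cast
    rfl
  have hF0 : ∀ y, 0 ≤ F y := fun y => by
    rw [hFw]
    exact hφ.trace_nonneg n (norm_nonneg _) (Finset.sum_nonneg fun i _ => sq_nonneg _) (hbessel _)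
  rw [heq]
  refine mul_le_mul_of_nonneg_left ?_ (by positivity)
  set U := Metric.closedBall x (3 / 2 * ε) \ Metric.closedBall x (3 / 4 * ε) with hU
  have hUm : MeasurableSet U :=
    Metric.isClosed_closedBall.measurableSet.diff Metric.isClosed_closedBall.measurableSet
  have hUfin : μ U ≠ ⊤ := ((measure_mono sdiff_subset).trans_lt
    (h.measure_closedBall_lt_top htop hx (by positivity : 0 < 3 / 2 * ε))).ne
  refine le_trans ?_ (setIntegral_le_integral (s := U) hFi (ae_of_all _ hF0))
  refine setIntegral_ge_of_const_le_real hUm hUfin (fun y hy => ?_) hFi.integrableOn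
  rw [hFw]
  refine hφ.trace_lower n ⟨?_, ?_⟩ (Finset.sum_nonneg fun i _ => sq_nonneg _) (hbessel _)
  · by_contra hlt
    exact hy.2 ((norm_inv_smul_sub_le_iff hε x y _).1 (not_le.1 hlt).le)
  · exact (norm_inv_smul_sub_le_iff hε x y _).2 hy.1

/-- The smoothly truncated Riesz kernel is a rescaled radial field. -/
theorem truncation_smul_rieszKernel {ψ : ℝ → ℝ} (heq : ∀ t, 0 ≤ t → φ t = ψ t) {ε : ℝ}
    (hε : 0 < ε) (z : EuclideanSpace ℝ (Fin d)) :
    truncation ψ ε z • rieszKernel n z = scaledKernel n (rieszProfile n φ) ε z := by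
  by_cases hz : z = 0
  · simp [hz, rieszKernel, scaledKernel, radialField]
  have hz0 : 0 < ‖z‖ := norm_pos_iff.2 hz
  rw [scaledKernel, radialField, rieszProfile, norm_inv_smul hε,
    sq_rpow_neg_half n (by positivity), truncation, rieszKernel, div_pow, heq _ (by positivity),
    smul_smul, smul_smul, smul_smul]
  congr 1
  rw [div_pow]
  field_simp
  ring

theorem IsCutoff.scaledKernel_eq_of_lt (hφ : IsCutoff φ φ₁ φ₂ B c) {ε R : ℝ} (hε : 0 < ε)
    (hR : ε ≤ R) {z : EuclideanSpace ℝ (Fin d)} (hz : 2 * R < ‖z‖) :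
    scaledKernel n (rieszProfile n φ) ε z = rieszKernel n z := by
  rw [← truncation_smul_rieszKernel (fun _ _ => rfl) hε, truncation, hφ.eq_one, one_smul]
  rw [← div_pow]
  have : 2 < ‖z‖ / ε := by rw [lt_div_iff₀ hε]; linarith
  nlinarith

/-- Differences of truncations at two scales are integrable, being bounded with bounded support. -/
theorem IsADRegular.integrable_scaledKernel_sub (h : IsADRegular n C μ)
    (htop : Metric.ediam μ.support = ⊤) (hφ : IsCutoff φ φ₁ φ₂ B c)
    (hg : IsRadialProfile n A (rieszProfile n φ) g₁ g₂)
    {ε ε' : ℝ} (hε : 0 < ε) (hε' : 0 < ε') {x : EuclideanSpace ℝ (Fin d)} (hx : x ∈ μ.support) :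
    Integrable (fun y => scaledKernel n (rieszProfile n φ) ε (x - y) -
      scaledKernel n (rieszProfile n φ) ε' (x - y)) μ := by
  set R := max ε ε' with hR
  have hR0 : 0 < R := lt_max_of_lt_left hε
  have hcont : Continuous fun y => scaledKernel n (rieszProfile n φ) ε (x - y) -
      scaledKernel n (rieszProfile n φ) ε' (x - y) :=
    ((hg.continuous_scaledKernel ε).comp (by fun_prop)).sub
      ((hg.continuous_scaledKernel ε').comp (by fun_prop))
  have hb : ∀ s : ℝ, 0 < s → ∀ z : EuclideanSpace ℝ (Fin d),
      ‖scaledKernel n (rieszProfile n φ) s z‖ ≤ (s ^ n)⁻¹ * A := fun s hs z => by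
    rw [scaledKernel, norm_smul, norm_inv, norm_pow, Real.norm_eq_abs, abs_of_pos hs]
    gcongr
    exact hg.norm_radialField_le _
  refine IntegrableOn.integrable_of_forall_notMem_eq_zero (s := Metric.closedBall x (2 * R))
    (Measure.integrableOn_of_bounded (M := (ε ^ n)⁻¹ * A + (ε' ^ n)⁻¹ * A)
      (h.measure_closedBall_lt_top htop hx (by positivity)).ne hcont.aestronglyMeasurable
      (ae_of_all _ fun y => (norm_sub_le _ _).trans (add_le_add (hb ε hε _) (hb ε' hε' _)))) ?_
  intro y hy
  rw [mem_closedBall_iff_norm', not_le] at hy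
  rw [hφ.scaledKernel_eq_of_lt hε (le_max_left _ _) hy,
    hφ.scaledKernel_eq_of_lt hε' (le_max_right _ _) hy, sub_self]

theorem rieszPiece_eq {ψ : ℝ → ℝ} (heq : ∀ t, 0 ≤ t → φ t = ψ t) (m : ℤ)
    (x : EuclideanSpace ℝ (Fin d)) :
    rieszPiece n ψ μ m x = ∫ y, (scaledKernel n (rieszProfile n φ) ((2 : ℝ) ^ (-(m + 1))) (x - y) -
      scaledKernel n (rieszProfile n φ) ((2 : ℝ) ^ (-m)) (x - y)) ∂μ := by
  have e : -m - 1 = -(m + 1) := by ring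
  simp only [rieszPiece, sub_smul, truncation_smul_rieszKernel heq (zpow_pos two_pos _), e]

/-- Consecutive pieces of the Riesz transform add up to a difference of two truncations. -/
theorem IsADRegular.sum_rieszPiece (h : IsADRegular n C μ)
    (htop : Metric.ediam μ.support = ⊤) (hφ : IsCutoff φ φ₁ φ₂ B c)
    (hg : IsRadialProfile n A (rieszProfile n φ) g₁ g₂) {ψ : ℝ → ℝ}
    (heq : ∀ t, 0 ≤ t → φ t = ψ t) (m : ℤ) (p : ℕ) {x : EuclideanSpace ℝ (Fin d)}
    (hx : x ∈ μ.support) :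
    ∑ q ∈ Finset.range p, rieszPiece n ψ μ (m + q) x =
      ∫ y, (scaledKernel n (rieszProfile n φ) ((2 : ℝ) ^ (-(m + p))) (x - y) -
        scaledKernel n (rieszProfile n φ) ((2 : ℝ) ^ (-m)) (x - y)) ∂μ := by
  induction p with
  | zero => simp
  | succ p ih =>
    rw [Finset.sum_range_succ, ih, rieszPiece_eq heq, ← integral_add
      (h.integrable_scaledKernel_sub htop hφ hg (zpow_pos two_pos _) (zpow_pos two_pos _) hx)
      (h.integrable_scaledKernel_sub htop hφ hg (zpow_pos two_pos _) (zpow_pos two_pos _) hx)]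
    have e : m + ((p + 1 : ℕ) : ℤ) = m + p + 1 := by push_cast; ring
    rw [e]
    congr 1
    ext1 y
    abel

theorem IsADRegular.integral_scaledKernel_sub_sub (h : IsADRegular n C μ)
    (htop : Metric.ediam μ.support = ⊤) (hφ : IsCutoff φ φ₁ φ₂ B c)
    (hg : IsRadialProfile n A (rieszProfile n φ) g₁ g₂)
    {ε ε' : ℝ} (hε : 0 < ε) (hε' : 0 < ε') {x x₀ : EuclideanSpace ℝ (Fin d)} (hx : x ∈ μ.support)
    (hx₀ : x₀ ∈ μ.support) (hxε : ‖x - x₀‖ ≤ ε / 2) (hxε' : ‖x - x₀‖ ≤ ε' / 2) :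
    ∫ y, (scaledKernel n (rieszProfile n φ) ε (x - y) -
        scaledKernel n (rieszProfile n φ) ε' (x - y)) ∂μ -
      ∫ y, (scaledKernel n (rieszProfile n φ) ε (x₀ - y) -
        scaledKernel n (rieszProfile n φ) ε' (x₀ - y)) ∂μ =
      ∫ y, (scaledKernel n (rieszProfile n φ) ε (x - y) -
        scaledKernel n (rieszProfile n φ) ε (x₀ - y)) ∂μ -
      ∫ y, (scaledKernel n (rieszProfile n φ) ε' (x - y) -
        scaledKernel n (rieszProfile n φ) ε' (x₀ - y)) ∂μ := by
  rw [← integral_sub (h.integrable_scaledKernel_sub htop hφ hg hε hε' hx)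
      (h.integrable_scaledKernel_sub htop hφ hg hε hε' hx₀),
    ← integral_sub (h.norm_integral_scaledKernel_sub_le htop hg hε hx₀ hxε).1
      (h.norm_integral_scaledKernel_sub_le htop hg hε' hx₀ hxε').1]
  congr 1
  ext1 y
  abel

/-- A piece `S_m μ` of the Riesz transform has Lipschitz constant `O(2ᵐ)` on the support. -/
theorem IsADRegular.norm_rieszPiece_sub_le (h : IsADRegular n C μ)
    (htop : Metric.ediam μ.support = ⊤) (hφ : IsCutoff φ φ₁ φ₂ B c)
    (hg : IsRadialProfile n A (rieszProfile n φ) g₁ g₂) {ψ : ℝ → ℝ}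
    (heq : ∀ t, 0 ≤ t → φ t = ψ t) (m : ℤ) {x x₀ : EuclideanSpace ℝ (Fin d)}
    (hx : x ∈ μ.support) (hx₀ : x₀ ∈ μ.support) (hxx : ‖x - x₀‖ ≤ 1 / 4 * (2 : ℝ) ^ (-m)) :
    ‖rieszPiece n ψ μ m x - rieszPiece n ψ μ m x₀‖ ≤
      3 * (2 ^ (n + 1) * C * (2 ^ (n + 1) * (3 * A))) * (‖x - x₀‖ / (2 : ℝ) ^ (-m)) := by
  set ε' := (2 : ℝ) ^ (-m) with hε'
  have hε'0 : 0 < ε' := zpow_pos two_pos _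
  have e : (2 : ℝ) ^ (-(m + 1)) = ε' / 2 := by
    rw [neg_add, zpow_add₀ two_ne_zero, zpow_neg_one, div_eq_mul_inv]
  rw [rieszPiece_eq heq, rieszPiece_eq heq, ← hε', e,
    h.integral_scaledKernel_sub_sub htop hφ hg (by positivity) hε'0 hx hx₀ (by linarith)
      (by linarith)]
  have h1 := (h.norm_integral_scaledKernel_sub_le htop hg (half_pos hε'0) hx₀ (x := x)
    (by linarith)).2
  have h2 := (h.norm_integral_scaledKernel_sub_le htop hg hε'0 hx₀ (x := x) (by linarith)).2
  refine ((norm_sub_le _ _).trans (add_le_add h1 h2)).trans_eq ?_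
  field_simp
  ring

end ScaledKernel

/-! ### Flatness and the coefficient `β₁` -/

section Flatness

/-- If the pieces of the Riesz transform at finitely many scales above `2⁻ⁱ` are small on a set
`F` of diameter comparable to `2⁻ⁱ`, then `F` lies close to an `n`-plane. -/
theorem IsTruncationProfile.exists_plane_near {n : ℕ} (hn : 1 ≤ n) {φ : ℝ → ℝ} {C η : ℝ}
    (hφ : IsTruncationProfile φ) (hC : 0 < C) (hη : 0 < η) :
    ∃ (δ : ℝ) (N : ℕ), 0 < δ ∧ ∀ (d : ℕ), n < d → ∀ μ : Measure (EuclideanSpace ℝ (Fin d)),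
      IsADRegular n C μ → Metric.ediam μ.support = ⊤ → ∀ (i : ℤ) (x₀ : EuclideanSpace ℝ (Fin d))
      (F : Set (EuclideanSpace ℝ (Fin d))), x₀ ∈ F → F ⊆ μ.support →
      (∀ x ∈ F, ‖x - x₀‖ ≤ 2 * (2 : ℝ) ^ (-i)) →
      (∀ x ∈ F, ∀ k : ℤ, -N ≤ k → k < 0 → ‖rieszPiece n φ μ (i + k) x‖ ≤ δ) →
      ∃ W : Submodule ℝ (EuclideanSpace ℝ (Fin d)), Module.finrank ℝ W = n ∧
        ∀ x ∈ F, ∃ w ∈ W, ‖x - x₀ - w‖ < η * (2 : ℝ) ^ (-i) := by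
  obtain ⟨ψ, ψ₁, ψ₂, B, c, hψ, heq⟩ := hφ.exists_isCutoff
  obtain ⟨A, g₂, hg⟩ := hψ.isRadialProfile n
  have hA := hg.pos
  have hc := hψ.c_pos
  obtain ⟨M, hM, hortho⟩ := exists_orthonormal_norm_map_le n hη (n + 1) le_rfl
  obtain ⟨J, hJ⟩ : ∃ J : ℕ, C * (C + 1) ≤ 2 ^ J ∧ 0 < J := by
    obtain ⟨J, hJ⟩ := pow_unbounded_of_one_lt (C * (C + 1)) one_lt_two
    exact ⟨J + 1, hJ.le.trans (pow_le_pow_right₀ one_le_two J.le_succ), J.succ_pos⟩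
  obtain ⟨hJ, hJ0⟩ := hJ
  have hJ0' : (0 : ℝ) < J := by exact_mod_cast hJ0
  -- `c₃` bounds below the trace of the linearized transform at a scale given by `exists_annulus`.
  set c₃ : ℝ := (2 ^ (n + 1))⁻¹ * c * ((3 / 4) ^ n / (2 ^ J) ^ n / J) with hc₃
  have hc₃0 : 0 < c₃ := by positivity
  set τ : ℝ := c₃ / (2 * ((n + 1) * M)) with hτ
  have hτ0 : 0 < τ := by positivity
  set K₁ : ℝ := 2 ^ (n + 1) * C * (2 ^ (n + 1) * (3 * A)) with hK₁
  set K₂ : ℝ := 2 ^ (n + 1) * C * (2 ^ (n + 2) * (10 * A)) with hK₂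
  have hK₁0 : 0 < K₁ := by positivity
  have hK₂0 : 0 < K₂ := by positivity
  -- The lower scale `2 ^ a` makes the quadratic error small, then the upper scale `2 ^ N` makes
  -- the contribution of the outer truncation small, then `δ` makes the sum of the pieces small.
  obtain ⟨a, ha2, ha⟩ : ∃ a : ℕ, 2 ≤ a ∧ 4 * K₂ / 2 ^ a ≤ τ / 3 := by
    obtain ⟨a, ha⟩ := pow_unbounded_of_one_lt (4 * K₂ / (τ / 3)) one_lt_two
    refine ⟨a + 2, by omega, ?_⟩
    rw [div_le_comm₀ (by positivity) (by positivity)]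
    exact ha.le.trans (pow_le_pow_right₀ one_le_two (by omega))
  obtain ⟨N, hNa, hN⟩ : ∃ N : ℕ, a + J ≤ N ∧ 2 * K₁ * 2 ^ (a + J) / 2 ^ N ≤ τ / 3 := by
    obtain ⟨N, hN⟩ := pow_unbounded_of_one_lt (2 * K₁ * 2 ^ (a + J) / (τ / 3)) one_lt_two
    refine ⟨N + (a + J), by omega, ?_⟩
    rw [div_le_comm₀ (by positivity) (by positivity)]
    exact hN.le.trans (pow_le_pow_right₀ one_le_two (by omega))
  set δ : ℝ := τ / (6 * (N + 1) * 2 ^ (a + J)) with hδ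
  have hδ0 : 0 < δ := by positivity
  refine ⟨δ, N, hδ0, ?_⟩
  intro d hd μ hμ htop i x₀ F hx₀F hFs hFd hsmall
  by_contra! hfar
  set ℓ : ℝ := (2 : ℝ) ^ (-i) with hℓ
  have hℓ0 : 0 < ℓ := zpow_pos two_pos _
  have hx₀ := hFs hx₀F
  obtain ⟨j, hjJ, hj⟩ := hμ.exists_annulus hn htop hx₀ hJ (ρ := 3 / 4 * (2 ^ a * ℓ))
    (by positivity)
  set ε : ℝ := 2 ^ (a + j) * ℓ with hε
  have hε0 : 0 < ε := by positivity
  set T := linearizedTransform n (rieszProfile n ψ) (rieszProfileDeriv n ψ ψ₁) μ ε x₀ with hT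
  have htrace : ∀ e : Fin (n + 1) → EuclideanSpace ℝ (Fin d), Orthonormal ℝ e →
      c₃ ≤ ∑ i, inner ℝ (e i) (T (e i)) := by
    intro e he
    refine le_trans ?_ (hμ.le_sum_inner_linearizedTransform htop hψ hg hε0 hx₀ he)
    have e1 : 3 / 2 * ε = 2 ^ (j + 1) * (3 / 4 * (2 ^ a * ℓ)) := by
      rw [hε, pow_add, pow_add]; ring
    have e2 : 3 / 4 * ε = 2 ^ j * (3 / 4 * (2 ^ a * ℓ)) := by
      rw [hε, pow_add]; ring
    rw [e1, e2]
    calc c₃ ≤ (2 ^ (n + 1))⁻¹ * c * ((3 / 4) ^ n / (2 ^ j) ^ n / J) := by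
          rw [hc₃]
          gcongr
          norm_num
      _ = (ε ^ n)⁻¹ * ((2 ^ (n + 1))⁻¹ * c * ((3 / 4 * (2 ^ a * ℓ)) ^ n / J)) := by
          rw [hε, pow_add 2 a j, mul_pow, mul_pow, mul_pow, mul_pow]
          field_simp
      _ ≤ _ := by gcongr
  -- Smallness of the pieces forces `T` to be small on the increments of `F`.
  have hTsmall : ∀ x ∈ F, ‖T (ℓ⁻¹ • (x - x₀))‖ ≤ τ := by
    intro x hx
    have hxs := hFs hx
    have hxd := hFd x hx
    have h4 : (4 : ℝ) ≤ 2 ^ (a + j) := by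
      calc (4 : ℝ) = 2 ^ 2 := by norm_num
        _ ≤ 2 ^ (a + j) := pow_le_pow_right₀ one_le_two (by omega)
    have hεN : ε ≤ 2 ^ N * ℓ := by
      rw [hε]
      gcongr
      · norm_num
      · omega
    have hxε : ‖x - x₀‖ ≤ ε / 2 := by rw [hε]; nlinarith
    have hxN : ‖x - x₀‖ ≤ 2 ^ N * ℓ / 2 := by linarith
    obtain ⟨p, hp⟩ : ∃ p : ℕ, p + (a + j) = N := ⟨N - (a + j), by omega⟩
    have s1 : (2 : ℝ) ^ (-(i - N + p)) = ε := by
      have : -(i - (N : ℤ) + p) = ((a + j : ℕ) : ℤ) + -i := by rw [← hp]; push_cast; ring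
      rw [this, zpow_add₀ two_ne_zero, zpow_natCast]
    have s2 : (2 : ℝ) ^ (-(i - N)) = 2 ^ N * ℓ := by
      have : -(i - (N : ℤ)) = (N : ℤ) + -i := by ring
      rw [this, zpow_add₀ two_ne_zero, zpow_natCast]
    have hsum : ∀ y ∈ F, ‖∑ q ∈ Finset.range p, rieszPiece n φ μ (i - N + q) y‖ ≤ N * δ := by
      intro y hy
      calc _ ≤ ∑ q ∈ Finset.range p, ‖rieszPiece n φ μ (i - N + q) y‖ := norm_sum_le _ _
        _ ≤ ∑ _q ∈ Finset.range p, δ := by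
          refine Finset.sum_le_sum fun q hq => ?_
          have hq' := Finset.mem_range.1 hq
          have e : i - (N : ℤ) + q = i + (q - N) := by ring
          rw [e]
          exact hsmall y hy _ (by omega) (by omega)
        _ = p * δ := by simp
        _ ≤ N * δ := by
          gcongr
          omega
    have hVx := hsum x hx
    have hV₀ := hsum x₀ hx₀F
    rw [hμ.sum_rieszPiece htop hψ hg heq (i - N) p hxs, s1, s2] at hVx
    rw [hμ.sum_rieszPiece htop hψ hg heq (i - N) p hx₀, s1, s2] at hV₀
    have hdiff := (norm_sub_le _ _).trans (add_le_add hVx hV₀)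
    rw [hμ.integral_scaledKernel_sub_sub htop hψ hg hε0 (by positivity) hxs hx₀ hxε hxN] at hdiff
    have h1 := (hμ.norm_integral_scaledKernel_sub_le htop hg (ε := 2 ^ N * ℓ) (by positivity)
      hx₀ hxN).2
    have h2 := hμ.norm_integral_scaledKernel_sub_sub_le htop hg hε0 hx₀ hxε
    rw [← hK₁] at h1
    rw [← hK₂, ← hT] at h2
    set I₁ := ∫ y, (scaledKernel n (rieszProfile n ψ) ε (x - y) -
      scaledKernel n (rieszProfile n ψ) ε (x₀ - y)) ∂μ
    set I₂ := ∫ y, (scaledKernel n (rieszProfile n ψ) (2 ^ N * ℓ) (x - y) -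
      scaledKernel n (rieszProfile n ψ) (2 ^ N * ℓ) (x₀ - y)) ∂μ
    set t := T (ε⁻¹ • (x - x₀)) with ht
    have h3 : ‖t‖ ≤ (N * δ + N * δ) + K₁ * (‖x - x₀‖ / (2 ^ N * ℓ)) +
        K₂ * (‖x - x₀‖ / ε) ^ 2 := by
      have e : t = (I₁ - I₂) + I₂ - (I₁ - t) := by abel
      calc ‖t‖ = ‖(I₁ - I₂) + I₂ - (I₁ - t)‖ := by rw [← e]
        _ ≤ ‖I₁ - I₂‖ + ‖I₂‖ + ‖I₁ - t‖ :=
          (norm_sub_le _ _).trans (add_le_add (norm_add_le _ _) le_rfl)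
        _ ≤ _ := add_le_add (add_le_add hdiff h1) h2
    have hscale : T (ℓ⁻¹ • (x - x₀)) = (2 : ℝ) ^ (a + j) • t := by
      rw [ht, ← map_smul, smul_smul, hε, mul_inv, ← mul_assoc, mul_inv_cancel₀ (by positivity),
        one_mul]
    rw [hscale, norm_smul, norm_pow, Real.norm_eq_abs, abs_two]
    have hu : ‖x - x₀‖ / ℓ ≤ 2 := by rwa [div_le_iff₀ hℓ0]
    have hu0 : 0 ≤ ‖x - x₀‖ / ℓ := by positivity
    have b1 : ‖x - x₀‖ / (2 ^ N * ℓ) ≤ 2 / 2 ^ N := by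
      rw [mul_comm, ← div_div]; gcongr
    have b2 : (‖x - x₀‖ / ε) ^ 2 ≤ (2 / 2 ^ (a + j)) ^ 2 := by
      rw [hε, mul_comm, ← div_div]; gcongr
    have hja : (2 : ℝ) ^ (a + j) ≤ 2 ^ (a + J) := pow_le_pow_right₀ one_le_two (by omega)
    have haj : (2 : ℝ) ^ a ≤ 2 ^ (a + j) := pow_le_pow_right₀ one_le_two (by omega)
    have p1 : 2 ^ (a + J) * (2 * (N * δ)) ≤ τ / 3 := by
      have : (2 : ℝ) ^ (a + J) * (2 * ((N + 1) * δ)) = τ / 3 := by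
        rw [hδ]; field_simp; norm_num
      rw [← this]
      gcongr
      linarith
    calc 2 ^ (a + j) * ‖t‖ ≤ 2 ^ (a + j) * ((N * δ + N * δ) + K₁ * (2 / 2 ^ N) +
          K₂ * (2 / 2 ^ (a + j)) ^ 2) := by
          gcongr
          exact h3.trans (by gcongr)
      _ = 2 ^ (a + j) * (2 * (N * δ)) + 2 * K₁ * 2 ^ (a + j) / 2 ^ N + 4 * K₂ / 2 ^ (a + j) := by
          field_simp
          ring
      _ ≤ 2 ^ (a + J) * (2 * (N * δ)) + 2 * K₁ * 2 ^ (a + J) / 2 ^ N + 4 * K₂ / 2 ^ a := by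
          gcongr
      _ ≤ τ := by linarith
  obtain ⟨e, he, hTe⟩ := hortho (EuclideanSpace ℝ (Fin d)) (by simpa using hd.le) T τ hτ0.le
    ((fun x => ℓ⁻¹ • (x - x₀)) '' F)
    (by
      rintro _ ⟨x, hx, rfl⟩
      refine ⟨?_, hTsmall x hx⟩
      change ‖ℓ⁻¹ • (x - x₀)‖ ≤ 2
      rw [norm_inv_smul hℓ0, div_le_iff₀ hℓ0]
      exact hFd x hx)
    (by
      intro W hW
      obtain ⟨x, hx, hxW⟩ := hfar W hW
      refine ⟨_, mem_image_of_mem _ hx, fun w hw => ?_⟩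
      have h1 := hxW (ℓ • w) (W.smul_mem _ hw)
      have h2 : ℓ⁻¹ • (x - x₀) - w = ℓ⁻¹ • (x - x₀ - ℓ • w) := by
        rw [smul_sub ℓ⁻¹ (x - x₀), smul_smul, inv_mul_cancel₀ hℓ0.ne', one_smul]
      change η ≤ ‖ℓ⁻¹ • (x - x₀) - w‖
      rw [h2, norm_inv_smul hℓ0, le_div_iff₀ hℓ0]
      exact h1)
  have hle : ∑ i, inner ℝ (e i) (T (e i)) ≤ (n + 1) * (M * τ) := by
    calc _ ≤ ∑ _i : Fin (n + 1), M * τ := by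
          refine Finset.sum_le_sum fun i _ => ?_
          refine (real_inner_le_norm _ _).trans ?_
          rw [he.1 i, one_mul]
          exact hTe i
      _ = _ := by simp
  have hcontra := (htrace e he).trans hle
  have : (n + 1) * (M * τ) = c₃ / 2 := by rw [hτ]; field_simp
  linarith

/-- Closeness of `2Q` to one `n`-plane controls `betaOne`. -/
theorem IsADRegular.betaOne_le {n d : ℕ} {C η ℓ : ℝ} {μ : Measure (EuclideanSpace ℝ (Fin d))}
    (h : IsADRegular n C μ) (htop : Metric.ediam μ.support = ⊤) (hℓ : 0 < ℓ) (hη : 0 ≤ η)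
    {Q : Set (EuclideanSpace ℝ (Fin d))} {x₀ : EuclideanSpace ℝ (Fin d)} (hx₀ : x₀ ∈ μ.support)
    (hQ : ∀ x ∈ cubeDilate μ 2 ℓ Q, ‖x - x₀‖ ≤ 2 * ℓ)
    {W : Submodule ℝ (EuclideanSpace ℝ (Fin d))} (hW : Module.finrank ℝ W = n)
    (hnear : ∀ x ∈ cubeDilate μ 2 ℓ Q, ∃ w ∈ W, ‖x - x₀ - w‖ ≤ η * ℓ) :
    betaOne n μ ℓ Q ≤ 2 ^ n * C * η := by
  have hC := h.const_pos
  let L : {L : AffineSubspace ℝ (EuclideanSpace ℝ (Fin d)) //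
      (L : Set (EuclideanSpace ℝ (Fin d))).Nonempty ∧ Module.finrank ℝ L.direction = n} :=
    ⟨AffineSubspace.mk' x₀ W, ⟨x₀, AffineSubspace.self_mem_mk' x₀ W⟩, by
      rw [AffineSubspace.direction_mk']; exact hW⟩
  have hbdd : BddBelow (range fun L : {L : AffineSubspace ℝ (EuclideanSpace ℝ (Fin d)) //
      (L : Set (EuclideanSpace ℝ (Fin d))).Nonempty ∧ Module.finrank ℝ L.direction = n} =>
      (ℓ ^ n)⁻¹ * ∫ y in cubeDilate μ 2 ℓ Q,
        Metric.infDist y (L.1 : Set (EuclideanSpace ℝ (Fin d))) / ℓ ∂μ) := by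
    refine ⟨0, ?_⟩
    rintro _ ⟨L, rfl⟩
    have : 0 ≤ ∫ y in cubeDilate μ 2 ℓ Q,
        Metric.infDist y (L.1 : Set (EuclideanSpace ℝ (Fin d))) / ℓ ∂μ :=
      integral_nonneg fun y => div_nonneg Metric.infDist_nonneg hℓ.le
    positivity
  refine (ciInf_le hbdd L).trans ?_
  have hsub : cubeDilate μ 2 ℓ Q ⊆ Metric.closedBall x₀ (2 * ℓ) := fun x hx => by
    rw [mem_closedBall_iff_norm]; exact hQ x hx
  have hball := h.measure_closedBall_lt_top htop hx₀ (by positivity : 0 < 2 * ℓ)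
  have hmeas : μ.real (cubeDilate μ 2 ℓ Q) ≤ C * (2 * ℓ) ^ n :=
    (measureReal_mono hsub hball.ne).trans (h.measureReal_closedBall_le htop hx₀ (by positivity))
  have hint := norm_setIntegral_le_of_norm_le_const (μ := μ) (s := cubeDilate μ 2 ℓ Q) (C := η)
    (f := fun y => Metric.infDist y (L.1 : Set (EuclideanSpace ℝ (Fin d))) / ℓ)
    ((measure_mono hsub).trans_lt hball) (fun y hy => by
      rw [Real.norm_of_nonneg (div_nonneg Metric.infDist_nonneg hℓ.le), div_le_iff₀ hℓ]
      obtain ⟨w, hw, hle⟩ := hnear y hy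
      refine (Metric.infDist_le_dist_of_mem (y := w +ᵥ x₀) ?_).trans ?_
      · exact AffineSubspace.vadd_mem_mk' x₀ hw
      · rw [dist_eq_norm, vadd_eq_add, add_comm, ← sub_sub]
        exact hle)
  rw [inv_mul_le_iff₀ (by positivity)]
  calc _ ≤ η * μ.real (cubeDilate μ 2 ℓ Q) := (le_abs_self _).trans hint
    _ ≤ η * (C * (2 * ℓ) ^ n) := by gcongr
    _ = _ := by rw [mul_pow]; ring

theorem IsDyadicLattice.subset_support {n d : ℕ} {μ : Measure (EuclideanSpace ℝ (Fin d))}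
    {D : ℤ → Set (Set (EuclideanSpace ℝ (Fin d)))} (hD : IsDyadicLattice n μ D) {j : ℤ}
    {Q : Set (EuclideanSpace ℝ (Fin d))} (hQ : Q ∈ D j) : Q ⊆ μ.support := by
  rw [← hD.sUnion_eq j]
  exact subset_sUnion_of_mem hQ

theorem IsDyadicLattice.norm_sub_le {n d : ℕ} {μ : Measure (EuclideanSpace ℝ (Fin d))}
    {D : ℤ → Set (Set (EuclideanSpace ℝ (Fin d)))} (hD : IsDyadicLattice n μ D) {j : ℤ}
    {Q : Set (EuclideanSpace ℝ (Fin d))} (hQ : Q ∈ D j) {x y : EuclideanSpace ℝ (Fin d)}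
    (hx : x ∈ Q) (hy : y ∈ Q) : ‖x - y‖ ≤ (2 : ℝ) ^ (-j) := by
  rw [← dist_eq_norm, ← ENNReal.ofReal_le_ofReal_iff (zpow_nonneg zero_le_two _), ← edist_dist]
  exact (Metric.edist_le_ediam_of_mem hx hy).trans (hD.diam_le j Q hQ)

theorem IsDyadicLattice.nonempty {n d : ℕ} {μ : Measure (EuclideanSpace ℝ (Fin d))}
    {D : ℤ → Set (Set (EuclideanSpace ℝ (Fin d)))} (hD : IsDyadicLattice n μ D) {j : ℤ}
    {Q : Set (EuclideanSpace ℝ (Fin d))} (hQ : Q ∈ D j) : Q.Nonempty := by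
  obtain ⟨C, hC, h⟩ := hD.size
  rw [nonempty_iff_ne_empty]
  rintro rfl
  have h1 := (h j _ hQ).1
  rw [Metric.ediam_empty, nonpos_iff_eq_zero, ENNReal.ofReal_eq_zero] at h1
  have : 0 < C⁻¹ * (2 : ℝ) ^ (-j) := mul_pos (inv_pos.2 hC) (zpow_pos two_pos _)
  linarith

end Flatness

theorem proposition6p3 (n : ℕ) (hn : 1 ≤ n) (φ : ℝ → ℝ) (hφ : IsTruncationProfile φ)
    (Cμ : ℝ) (ε₀ : ℝ) (hε₀ : 0 < ε₀) :
    ∃ (δ₀ : ℝ) (m₀ k₀ : ℕ), 0 < δ₀ ∧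
      ∀ (d : ℕ), n < d → ∀ (μ : MeasureTheory.Measure (EuclideanSpace ℝ (Fin d))),
        IsADRegular n Cμ μ → Metric.ediam μ.support = ⊤ →
        ∀ D : ℤ → Set (Set (EuclideanSpace ℝ (Fin d))), IsDyadicLattice n μ D →
        ∀ i : ℤ, ∀ Q ∈ D i, ε₀ < betaOne n μ ((2 : ℝ) ^ (-i)) Q →
          ∃ k : ℤ, |k| ≤ (k₀ : ℤ) ∧
            ∃ P ∈ D (i + k + (m₀ : ℤ)), P ⊆ cubeDilate μ 4 ((2 : ℝ) ^ (-i)) Q ∧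
              ∀ x ∈ P, δ₀ ≤ ‖rieszPiece n φ μ (i + k) x‖ := by
  by_cases hC : 0 < Cμ
  swap
  · exact ⟨1, 0, 0, one_pos, fun d _ μ hμ => absurd hμ.const_pos hC⟩
  obtain ⟨ψ, ψ₁, ψ₂, B, c, hψ, heq⟩ := hφ.exists_isCutoff
  obtain ⟨A, g₂, hg⟩ := hψ.isRadialProfile n
  have hA := hg.pos
  set η : ℝ := ε₀ / (2 ^ n * Cμ) with hη
  obtain ⟨δ, N, hδ, hflat⟩ := hφ.exists_plane_near hn (C := Cμ) (η := η) hC (by positivity)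
  set K : ℝ := 3 * (2 ^ (n + 1) * Cμ * (2 ^ (n + 1) * (3 * A))) with hK
  have hK0 : 0 < K := by positivity
  -- `m₀` is so large that the pieces oscillate by at most `δ / 2` on cubes `P`.
  obtain ⟨m₀, hm₀N, hm₀2, hm₀⟩ : ∃ m₀ : ℕ, N ≤ m₀ ∧ 2 ≤ m₀ ∧ K * (2 ^ m₀)⁻¹ ≤ δ / 2 := by
    obtain ⟨m, hm⟩ := pow_unbounded_of_one_lt (K / (δ / 2)) one_lt_two
    refine ⟨m + N + 2, by omega, by omega, ?_⟩
    rw [← div_eq_mul_inv, div_le_comm₀ (by positivity) (by positivity)]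
    exact hm.le.trans (pow_le_pow_right₀ one_le_two (by omega))
  refine ⟨δ / 2, m₀, N, half_pos hδ, ?_⟩
  intro d hd μ hμ htop D hD i Q hQ hβ
  by_contra! hcon
  set ℓ : ℝ := (2 : ℝ) ^ (-i) with hℓ
  have hℓ0 : 0 < ℓ := zpow_pos two_pos _
  obtain ⟨x₀, hx₀Q⟩ := hD.nonempty hQ
  have hx₀ := hD.subset_support hQ hx₀Q
  have hdist : ∀ x ∈ cubeDilate μ 2 ℓ Q, ‖x - x₀‖ ≤ 2 * ℓ := by
    intro x hx
    have hbdd : Bornology.IsBounded Q := Metric.isBounded_iff.2 ⟨ℓ, fun y hy z hz => by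
      rw [dist_eq_norm]; exact hD.norm_sub_le hQ hy hz⟩
    have h1 := Metric.dist_le_infDist_add_diam hbdd hx₀Q (x := x)
    have h2 : Metric.diam Q ≤ ℓ := Metric.diam_le_of_forall_dist_le hℓ0.le fun y hy z hz => by
      rw [dist_eq_norm]; exact hD.norm_sub_le hQ hy hz
    rw [← dist_eq_norm]
    linarith [hx.2]
  have hx₀2 : x₀ ∈ cubeDilate μ 2 ℓ Q :=
    ⟨hx₀, by rw [Metric.infDist_zero_of_mem hx₀Q]; linarith⟩
  have hsmall : ∀ x ∈ cubeDilate μ 2 ℓ Q, ∀ k : ℤ, -N ≤ k → k < 0 →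
      ‖rieszPiece n φ μ (i + k) x‖ ≤ δ := by
    intro x hx k hkN hk0
    obtain ⟨P, hP, hxP⟩ : ∃ P ∈ D (i + k + m₀), x ∈ P := by
      have := hx.1
      rw [← hD.sUnion_eq (i + k + m₀)] at this
      exact this
    have hPs := hD.subset_support hP
    have hPℓ : (2 : ℝ) ^ (-(i + k + (m₀ : ℤ))) ≤ ℓ := by
      rw [hℓ]
      exact zpow_le_zpow_right₀ one_le_two (by omega)
    have hP4 : P ⊆ cubeDilate μ 4 ℓ Q := by
      intro y hy
      refine ⟨hPs hy, ?_⟩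
      have h1 := Metric.infDist_le_infDist_add_dist (s := Q) (x := y) (y := x)
      have h2 := hD.norm_sub_le hP hy hxP
      rw [dist_eq_norm] at h1
      linarith [hx.2]
    obtain ⟨x', hx'P, hx'⟩ := hcon k (abs_le.2 ⟨hkN, by omega⟩) P hP hP4
    have hscale : (2 : ℝ) ^ (-(i + k + (m₀ : ℤ))) = (2 ^ m₀)⁻¹ * (2 : ℝ) ^ (-(i + k)) := by
      rw [neg_add, zpow_add₀ two_ne_zero, zpow_neg _ (m₀ : ℤ), zpow_natCast, mul_comm]
    have hxx' := hD.norm_sub_le hP hxP hx'P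
    rw [hscale] at hxx'
    have hpos : (0 : ℝ) < (2 : ℝ) ^ (-(i + k)) := zpow_pos two_pos _
    have hquarter : ((2 : ℝ) ^ m₀)⁻¹ ≤ 1 / 4 := by
      rw [one_div]
      refine inv_anti₀ (by norm_num) ?_
      calc (4 : ℝ) = 2 ^ 2 := by norm_num
        _ ≤ 2 ^ m₀ := pow_le_pow_right₀ one_le_two hm₀2
    have hlip := hμ.norm_rieszPiece_sub_le htop hψ hg heq (i + k) (hPs hxP) (hPs hx'P)
      (hxx'.trans (by gcongr))
    rw [← hK] at hlip
    have hlip' : ‖rieszPiece n φ μ (i + k) x - rieszPiece n φ μ (i + k) x'‖ ≤ δ / 2 := by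
      refine hlip.trans (le_trans ?_ hm₀)
      gcongr
      rwa [div_le_iff₀ hpos]
    have := norm_le_norm_add_norm_sub' (rieszPiece n φ μ (i + k) x) (rieszPiece n φ μ (i + k) x')
    linarith
  obtain ⟨W, hW, hnear⟩ := hflat d hd μ hμ htop i x₀ (cubeDilate μ 2 ℓ Q) hx₀2
    (fun x hx => hx.1) hdist hsmall
  have hle := hμ.betaOne_le htop hℓ0 (by positivity : 0 ≤ η) hx₀ hdist hW fun x hx => by
    obtain ⟨w, hw, h⟩ := hnear x hx
    exact ⟨w, hw, h.le⟩
  have : 2 ^ n * Cμ * η = ε₀ := by rw [hη]; field_simp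
  linarith
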